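/- Let $\lambda,n,\mu\in\mathbb R$ with $n>0$, $\mu\neq0$, $\lambda<1$ and $\lambda\neq 1-n^2$. On $\mathbb R^{1+3}$, with inertial coordinates $(x^\alpha)=(t,x)$ in which the medium is at rest, let $g^{\alpha\beta}=\mathrm{diag}(-1,1,1,1)$, $u=\partial_t$, $$\gamma^{\alpha\beta}=g^{\alpha\beta}+(1-n^2)u^\alpha u^\beta,\qquad \mathfrak m^{\alpha\beta}=g^{\alpha\beta}+\lambda u^\alpha u^\beta,$$ let $(\gamma_{\alpha\beta})$ be the inverse matrix of $(\gamma^{\alpha\beta})$, and put $\Box_\gamma=\gamma^{\alpha\beta}\partial_\alpha\partial_\beta$, $\Box_{\mathfrak m}=\mathfrak m^{\alpha\beta}\partial_\alpha\partial_\beta$. For a real covector field $A_\alpha$ let $F_{\alpha\beta}=\partial_\alpha A_\beta-\partial_\beta A_\alpha$ and $G^{\alpha\beta}=\gamma^{\alpha\rho}\gamma^{\beta\sigma}F_{\rho\sigma}$. Consider the field equation $$\Box_\gamma A_\beta-\gamma^{\sigma\rho}\partial_\beta\partial_\sigma A_\rho-\mu^2A_\sigma\mathfrak m^{\sigma\rho}\gamma_{\rho\beta}=0,\tag{1}$$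 the constraints $$\partial_\alpha(\mathfrak m^{\alpha\beta}A_\beta)=0,\qquad \mu^2\mathfrak m^{\alpha0}A_\alpha=\partial_iG^{i0},\tag{2}$$ and the system of wave equations for $A_\alpha$ and an auxiliary function $\varphi$ $$\big(\Box_{\mathfrak m}-\mu^2n^{-2}(1-\lambda)\big)A_0=0,\quad (\Box_\gamma-\mu^2)A_i=(1-\lambda-n^2)\,\partial_i\varphi,\quad \Box_{\mathfrak m}\varphi=\mu^2n^{-2}(1-\lambda)\varphi.\tag{3}$$ Call a smooth function slowly increasing if it and each of its partial derivatives grow at most polynomially. Then: (a) The map $A\mapsto(A_i|_{t=0},\partial_tA_i|_{t=0})_{i=1,2,3}$ is a bijection from the slowly increasing solutions $A$ of (1) on $\mathbb R^{1+3}$ onto all pairs $(\vec a,\vec b)$ of slowly increasing fields $\vec a,\vec b:\mathbb R^3\to\mathbb R^3$. (b) A smooth field $A$ (with no growth condition) satisfies (1) on $\mathbb R^{1+3}$ if and only if both constraints (2) hold at $t=0$ and there is a smooth function $\varphi$ with $$\varphi|_{t=0}=\tfrac1{1-\lambda}\partial_iA_i|_{t=0},\qquad \partial_t\varphi|_{t=0}=\tfrac1{1-\lambda}\partial_i\partial_tA_i|_{t=0}$$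 such that $(A,\varphi)$ satisfies (3). (c) Let $\vec a,\vec b$ be slowly increasing fields on $\mathbb R^3$. There is a unique slowly increasing function $a_0$ on $\mathbb R^3$ with $$\big(\Delta-(1-\lambda)n^{-2}\mu^2\big)a_0=\partial_ib_i ,$$ and with this $a_0$ the system (3) with the initial data $$A_i=a_i,\quad \partial_tA_i=b_i,\quad A_0=a_0,\quad \partial_tA_0=\varphi=\tfrac1{1-\lambda}\partial_ia_i,\quad \partial_t\varphi=\tfrac1{1-\lambda}\partial_ib_i\qquad(t=0)$$ has a unique smooth solution $(A,\varphi)$ on $\mathbb R^{1+3}$. This solution is slowly increasing, $\varphi=\partial_tA_0$, and $A$ satisfies (1). -/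

import Mathlib

open scoped ContDiff

/-- Euclidean three-space, with Cartesian coordinates `x¹, x², x³`. -/
abbrev Space : Type := EuclideanSpace ℝ (Fin 3)

/-- Flat spacetime in global inertial coordinates `(t, x)`, with `x⁰ = t`. -/
abbrev Spacetime : Type := ℝ × Space

/-- The coordinate vectors of spacetime: index `0` is the time direction, `i + 1` the `i`-th
spatial direction. -/
noncomputable def coordVec : Fin 4 → Spacetime :=
  Fin.cons ((1 : ℝ), (0 : Space)) (fun i : Fin 3 => ((0 : ℝ), EuclideanSpace.single i (1 : ℝ)))

/-- The partial derivative `∂_α f` on spacetime. In flat inertial coordinates this is also the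
covariant derivative, acting on components. -/
noncomputable def pd (α : Fin 4) (f : Spacetime → ℝ) : Spacetime → ℝ :=
  fun p => fderiv ℝ f p (coordVec α)

/-- The partial derivative `∂_i f` on space. -/
noncomputable def spd (i : Fin 3) (f : Space → ℝ) : Space → ℝ :=
  fun x => fderiv ℝ f x (EuclideanSpace.single i (1 : ℝ))

/-- The divergence `∂_i a_i` of a spatial field given by its components. -/
noncomputable def sdiv (a : Fin 3 → Space → ℝ) : Space → ℝ :=
  fun x => ∑ i, spd i (a i) x

/-- The Laplacian `∂_i ∂_i f` on space. -/
noncomputable def slap (f : Space → ℝ) : Space → ℝ :=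
  fun x => ∑ i, spd i (spd i f) x

/-- The inverse Minkowski metric `g^{αβ} = diag (-1, 1, 1, 1)`. -/
def minkowski : Matrix (Fin 4) (Fin 4) ℝ := Matrix.diagonal ![-1, 1, 1, 1]

/-- The four-velocity of the medium, `u = ∂_t`: the inertial coordinates are those in which
the inertially moving medium is at rest. -/
def fourVelocity : Fin 4 → ℝ := ![1, 0, 0, 0]

/-- The inverse optical metric of Gordon, `γ^{αβ} = g^{αβ} + (1 - n²) u^α u^β`. -/
def gordon (n : ℝ) : Matrix (Fin 4) (Fin 4) ℝ :=
  minkowski + (1 - n ^ 2) • Matrix.vecMulVec fourVelocity fourVelocity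

/-- The tensor of the mass term, `m^{αβ} = g^{αβ} + lam u^α u^β`. -/
def massTensor (lam : ℝ) : Matrix (Fin 4) (Fin 4) ℝ :=
  minkowski + lam • Matrix.vecMulVec fourVelocity fourVelocity

/-- The operator `M^{αβ} ∂_α ∂_β` of a constant matrix `M`. -/
noncomputable def box (M : Matrix (Fin 4) (Fin 4) ℝ) (f : Spacetime → ℝ) : Spacetime → ℝ :=
  fun p => ∑ α, ∑ β, M α β * pd α (pd β f) p

/-- The field equation
`γ^{αρ} ∂_α ∂_ρ A_β - γ^{σρ} ∂_β ∂_σ A_ρ - mu² A_σ m^{σρ} γ_{ρβ} = 0`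
for a covector field with components `A_β`; here `γ_{ρβ}` is the inverse matrix of `γ^{αβ}`. -/
def FieldEquation (n lam mu : ℝ) (A : Fin 4 → Spacetime → ℝ) : Prop :=
  ∀ (β : Fin 4) (p : Spacetime),
    box (gordon n) (A β) p
      - ∑ σ, ∑ ρ, gordon n σ ρ * pd β (pd σ (A ρ)) p
      - mu ^ 2 * ∑ σ, ∑ ρ, A σ p * massTensor lam σ ρ * (gordon n)⁻¹ ρ β = 0

/-- The field strength `F_{αβ} = ∂_α A_β - ∂_β A_α`. -/
noncomputable def fieldStrength (A : Fin 4 → Spacetime → ℝ) (α β : Fin 4) : Spacetime → ℝ :=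
  fun p => pd α (A β) p - pd β (A α) p

/-- The tensor `G^{αβ} = γ^{αρ} γ^{βσ} F_{ρσ}`. -/
noncomputable def displacement (n : ℝ) (A : Fin 4 → Spacetime → ℝ) (α β : Fin 4) :
    Spacetime → ℝ :=
  fun p => ∑ ρ, ∑ σ, gordon n α ρ * gordon n β σ * fieldStrength A ρ σ p

/-- The constraint `∂_α (m^{αβ} A_β) = 0` at the spacetime point `p`. -/
def DivergenceConstraintAt (lam : ℝ) (A : Fin 4 → Spacetime → ℝ) (p : Spacetime) : Prop :=
  ∑ α, pd α (fun q => ∑ β, massTensor lam α β * A β q) p = 0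

/-- The Gauss-type constraint `mu² m^{α0} A_α = ∂_i G^{i0}` at the spacetime point `p`. -/
def GaussConstraintAt (n lam mu : ℝ) (A : Fin 4 → Spacetime → ℝ) (p : Spacetime) : Prop :=
  mu ^ 2 * ∑ α, massTensor lam α 0 * A α p
    = ∑ i : Fin 3, pd i.succ (displacement n A i.succ 0) p

/-- The system of wave equations for the components `A_0, A_i` and the auxiliary field `φ`:
`(□_m - mu² n⁻² (1 - lam)) A_0 = 0`, `(□_γ - mu²) A_i = (1 - lam - n²) ∂_i φ` and
`□_m φ = mu² n⁻² (1 - lam) φ`. -/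
def WaveSystem (n lam mu : ℝ) (A : Fin 4 → Spacetime → ℝ) (φ : Spacetime → ℝ) : Prop :=
  (∀ p, box (massTensor lam) (A 0) p - mu ^ 2 / n ^ 2 * (1 - lam) * A 0 p = 0) ∧
  (∀ (i : Fin 3) (p : Spacetime),
    box (gordon n) (A i.succ) p - mu ^ 2 * A i.succ p
      = (1 - lam - n ^ 2) * pd i.succ φ p) ∧
  (∀ p, box (massTensor lam) φ p = mu ^ 2 / n ^ 2 * (1 - lam) * φ p)

/-- The elliptic equation `(Δ - (1 - lam) n⁻² mu²) a₀ = ∂_i b_i` of Helmholtz type on space. -/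
def HelmholtzEquation (n lam mu : ℝ) (b : Fin 3 → Space → ℝ) (a₀ : Space → ℝ) : Prop :=
  ∀ x, slap a₀ x - (1 - lam) / n ^ 2 * mu ^ 2 * a₀ x = sdiv b x

/-- The initial data at `t = 0` of the spatial components: the pair of `A_i` and `∂_t A_i`. -/
noncomputable def cauchyData (A : Fin 4 → Spacetime → ℝ) :
    (Fin 3 → Space → ℝ) × (Fin 3 → Space → ℝ) :=
  (fun i x => A i.succ (0, x), fun i x => pd 0 (A i.succ) (0, x))

/-- The initial data of `φ` determined by `a = A_i` and `b = ∂_t A_i` at `t = 0`: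
`φ = (1 - lam)⁻¹ ∂_i a_i` and `∂_t φ = (1 - lam)⁻¹ ∂_i b_i`. -/
def AuxiliaryData (lam : ℝ) (a b : Fin 3 → Space → ℝ) (φ : Spacetime → ℝ) : Prop :=
  ∀ x : Space, φ (0, x) = (1 - lam)⁻¹ * sdiv a x ∧ pd 0 φ (0, x) = (1 - lam)⁻¹ * sdiv b x

/-- The complete initial data for the system of wave equations determined by `a`, `b`, `a₀`. -/
def InitialData (lam : ℝ) (a b : Fin 3 → Space → ℝ) (a₀ : Space → ℝ)
    (A : Fin 4 → Spacetime → ℝ) (φ : Spacetime → ℝ) : Prop :=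
  cauchyData A = (a, b) ∧
  (∀ x : Space, A 0 (0, x) = a₀ x ∧ pd 0 (A 0) (0, x) = (1 - lam)⁻¹ * sdiv a x) ∧
  AuxiliaryData lam a b φ

/-- All components are smooth, and each of their derivatives grows at most polynomially. -/
def SlowlyIncreasing {ι E : Type*} [NormedAddCommGroup E] [NormedSpace ℝ E]
    (a : ι → E → ℝ) : Prop :=
  ∀ i, (a i).HasTemperateGrowth

/-! With `u = ∂_t` all coefficient matrices are diagonal. In the time component of the field
equation the second time derivatives cancel, and what remains is the Gauss constraint, an elliptic
equation for `A 0` on each time slice. Contracting the field equation with `γ^{αβ} ∂_α` annihilates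
the differential part and leaves `mu ^ 2` times the divergence constraint, which therefore
propagates for free (`FieldEquation.spatialDiv_eq`). Substituting it back with `φ = ∂_t A_0` turns
the field equation into the wave system. Conversely, for a solution of the wave system with
constrained data, `φ` and `∂_t A_0` solve the same Klein-Gordon equation with the same data, and so
do `∂_i A_i` and `(1 - lam) φ`; both pairs coincide, and the substitution can be undone
(`WaveSystem.fieldEquation`).

What remains is analysis of `-k ∂_t² + Δ - r` with `k > 0` and `r ≥ 0`: uniqueness for smooth
solutions (`kleinGordon_unique`), existence in the slowly increasing class (`exists_kleinGordon`),
and unique solvability of `Δ - r` with `r > 0` in that class. The Cauchy problem is solved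
explicitly: the wave equation in five dimensions by spherical means, the massive equation in three
dimensions by descent from the data `F(x) cos(m y)`, and sources by Duhamel's integral. Every
formula is an integral against a measure with finite moments, so slow increase is inherited from the
data. Uniqueness uses the same solution operator, along which a given solution is transported back
to time zero.

The Helmholtz equation is reduced to the massless wave equation. Its solution is a Laplace transform
in time of a wave; a homogeneous solution `a` gives the wave `a(x) cosh(√r t)`, whose exponential
growth excludes `a ≠ 0`. This is where slow increase enters the injectivity of the data map: it
fixes `A_0` at `t = 0`. -/

open MeasureTheory Filter Topology Function

set_option linter.unusedSectionVars false

/-! ### Smoothness and polynomial growth of integrals depending on a parameter. -/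

/-- Every derivative of the smooth family `H` is, locally uniformly in the parameter `x`,
dominated by an integrable function of the integration variable. -/
def SmoothDominated {X P F : Type} [NormedAddCommGroup X] [NormedSpace ℝ X]
    [NormedAddCommGroup P] [NormedSpace ℝ P] [MeasurableSpace P]
    [NormedAddCommGroup F] [NormedSpace ℝ F] (ν : Measure P) (H : X × P → F) : Prop :=
  ContDiff ℝ ∞ H ∧ ∀ (n : ℕ) (x₀ : X), ∃ s ∈ 𝓝 x₀, ∃ b : P → ℝ, Integrable b ν ∧
    ∀ᵐ p ∂ν, ∀ x ∈ s, ‖iteratedFDeriv ℝ n H (x, p)‖ ≤ b p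

section Parametric

variable {X P F : Type} [NormedAddCommGroup X] [NormedSpace ℝ X]
  [NormedAddCommGroup P] [NormedSpace ℝ P] [MeasurableSpace P]
  [NormedAddCommGroup F] [NormedSpace ℝ F] {ν : Measure P} {H : X × P → F}

/-- The partial derivative of a family in the direction of the parameter. -/
noncomputable def paramFDeriv (H : X × P → F) : X × P → (X →L[ℝ] F) :=
  fun z => (fderiv ℝ H z).comp (ContinuousLinearMap.inl ℝ X P)

theorem paramFDeriv_eq (H : X × P → F) : paramFDeriv H =
    ((ContinuousLinearMap.compL ℝ X (X × P) F).flip (ContinuousLinearMap.inl ℝ X P)) ∘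
      fderiv ℝ H := rfl

theorem contDiff_paramFDeriv (h : ContDiff ℝ ∞ H) : ContDiff ℝ ∞ (paramFDeriv H) := by
  rw [paramFDeriv_eq]
  exact (ContinuousLinearMap.contDiff _).comp (h.fderiv_right (by simp))

theorem hasFDerivAt_paramFDeriv (h : ContDiff ℝ ∞ H) (x : X) (p : P) :
    HasFDerivAt (fun x => H (x, p)) (paramFDeriv H (x, p)) x :=
  ((h.differentiable (by simp) (x, p)).hasFDerivAt).comp x
    ((hasFDerivAt_prodMk_left x p))

theorem exists_norm_iteratedFDeriv_paramFDeriv_le (h : ContDiff ℝ ∞ H) (n : ℕ) :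
    ∃ C : ℝ, 0 ≤ C ∧ ∀ z, ‖iteratedFDeriv ℝ n (paramFDeriv H) z‖ ≤
      C * ‖iteratedFDeriv ℝ (n + 1) H z‖ := by
  refine ⟨‖(ContinuousLinearMap.compL ℝ X (X × P) F).flip (ContinuousLinearMap.inl ℝ X P)‖,
    norm_nonneg _, fun z => ?_⟩
  rw [paramFDeriv_eq, ← norm_iteratedFDeriv_fderiv]
  exact ContinuousLinearMap.norm_iteratedFDeriv_comp_left _
    ((h.fderiv_right (m := ∞) (by simp)).contDiffAt) (by exact_mod_cast le_top)

theorem SmoothDominated.paramFDeriv (h : SmoothDominated ν H) :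
    SmoothDominated ν (paramFDeriv H) := by
  refine ⟨contDiff_paramFDeriv h.1, fun n x₀ => ?_⟩
  obtain ⟨C, hC, hb⟩ := exists_norm_iteratedFDeriv_paramFDeriv_le h.1 n
  obtain ⟨s, hs, b, hbi, hle⟩ := h.2 (n + 1) x₀
  refine ⟨s, hs, fun p => C * b p, hbi.const_mul C, ?_⟩
  filter_upwards [hle] with p hp x hx
  exact (hb _).trans (mul_le_mul_of_nonneg_left (hp x hx) hC)

variable [SecondCountableTopology P] [OpensMeasurableSpace P]

theorem SmoothDominated.integrable (h : SmoothDominated ν H) (x : X) :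
    Integrable (fun p => H (x, p)) ν := by
  obtain ⟨s, hs, b, hbi, hle⟩ := h.2 0 x
  refine hbi.mono' (h.1.continuous.comp (by fun_prop)).aestronglyMeasurable ?_
  filter_upwards [hle] with p hp
  simpa using hp x (mem_of_mem_nhds hs)

theorem SmoothDominated.hasFDerivAt_integral (h : SmoothDominated ν H) (x₀ : X) :
    HasFDerivAt (fun x => ∫ p, H (x, p) ∂ν) (∫ p, _root_.paramFDeriv H (x₀, p) ∂ν) x₀ := by
  obtain ⟨s, hs, b, hbi, hle⟩ := h.paramFDeriv.2 0 x₀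
  refine hasFDerivAt_integral_of_dominated_of_fderiv_le (F := fun x p => H (x, p))
    (F' := fun x p => _root_.paramFDeriv H (x, p)) hs ?_ (h.integrable x₀)
    (h.paramFDeriv.integrable x₀).aestronglyMeasurable ?_ hbi ?_
  · exact Eventually.of_forall fun x => (h.integrable x).aestronglyMeasurable
  · filter_upwards [hle] with p hp x hx
    simpa using hp x hx
  · exact Eventually.of_forall fun p x _ => hasFDerivAt_paramFDeriv h.1 x p

/-- The derivative of the integral is again the integral of a dominated family, now with values in
`X →L[ℝ] F`. The induction therefore ranges over all target spaces at once. -/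
theorem SmoothDominated.contDiff_nat_integral (n : ℕ) : ∀ {F : Type} [NormedAddCommGroup F]
    [NormedSpace ℝ F] {H : X × P → F}, SmoothDominated ν H →
      ContDiff ℝ n (fun x => ∫ p, H (x, p) ∂ν) := by
  induction n with
  | zero =>
    intro F _ _ H h
    exact contDiff_zero.2 (continuous_iff_continuousAt.2
      fun x => (h.hasFDerivAt_integral x).continuousAt)
  | succ n ih =>
    intro F _ _ H h
    refine (contDiff_succ_iff_fderiv (n := n)).2
      ⟨fun x => (h.hasFDerivAt_integral x).differentiableAt, by simp, ?_⟩
    rw [show fderiv ℝ (fun x => ∫ p, H (x, p) ∂ν) = fun x => ∫ p, _root_.paramFDeriv H (x, p) ∂ν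
      from funext fun x => (h.hasFDerivAt_integral x).fderiv]
    exact ih h.paramFDeriv

theorem SmoothDominated.contDiff_integral (h : SmoothDominated ν H) :
    ContDiff ℝ ∞ (fun x => ∫ p, H (x, p) ∂ν) :=
  contDiff_infty.2 fun n => h.contDiff_nat_integral n

theorem SmoothDominated.fderiv_integral (h : SmoothDominated ν H) :
    fderiv ℝ (fun x => ∫ p, H (x, p) ∂ν) = fun x => ∫ p, _root_.paramFDeriv H (x, p) ∂ν :=
  funext fun x => (h.hasFDerivAt_integral x).fderiv

theorem SmoothDominated.fderiv_integral_apply (h : SmoothDominated ν H) (x v : X) :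
    fderiv ℝ (fun x => ∫ p, H (x, p) ∂ν) x v = ∫ p, fderiv ℝ H (x, p) (v, 0) ∂ν := by
  rw [h.fderiv_integral, ContinuousLinearMap.integral_apply (h.paramFDeriv.integrable x)]
  rfl

theorem smoothDominated_of_compact [FiniteDimensional ℝ X] [IsFiniteMeasure ν] {K : Set P}
    (hK : IsCompact K) (hν : ∀ᵐ p ∂ν, p ∈ K) (h : ContDiff ℝ ∞ H) : SmoothDominated ν H := by
  refine ⟨h, fun n x₀ => ?_⟩
  obtain ⟨C, hC⟩ := ((isCompact_closedBall x₀ 1).prod hK).exists_bound_of_continuousOn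
    (h.continuous_iteratedFDeriv (m := n) (by exact_mod_cast le_top)).continuousOn
  refine ⟨Metric.closedBall x₀ 1, Metric.closedBall_mem_nhds x₀ one_pos, fun _ => C,
    integrable_const C, ?_⟩
  filter_upwards [hν] with p hp x hx
  exact hC (x, p) ⟨hx, hp⟩

/-- All moments of the measure are finite. -/
def HasMoments (ν : Measure P) : Prop := ∀ k : ℕ, Integrable (fun p => (1 + ‖p‖) ^ k) ν

theorem one_add_norm_prod_pow_le (x : X) (p : P) (k : ℕ) :
    (1 + ‖(x, p)‖) ^ k ≤ (1 + ‖x‖) ^ k * (1 + ‖p‖) ^ k := by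
  rw [← mul_pow]
  refine pow_le_pow_left₀ (by positivity) ?_ k
  have : ‖(x, p)‖ ≤ ‖x‖ + ‖p‖ := by
    rw [Prod.norm_def]
    exact max_le_add_of_nonneg (norm_nonneg _) (norm_nonneg _)
  nlinarith [mul_nonneg (norm_nonneg x) (norm_nonneg p)]

theorem Function.HasTemperateGrowth.smoothDominated (hν : HasMoments ν)
    (h : H.HasTemperateGrowth) : SmoothDominated ν H := by
  refine ⟨h.1, fun n x₀ => ?_⟩
  obtain ⟨k, C, hC0, hC⟩ := h.norm_iteratedFDeriv_le_uniform n
  refine ⟨Metric.closedBall x₀ 1, Metric.closedBall_mem_nhds x₀ one_pos,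
    fun p => C * (2 + ‖x₀‖) ^ k * (1 + ‖p‖) ^ k, (hν k).const_mul _, ?_⟩
  refine Eventually.of_forall fun p x hx => (hC n le_rfl _).trans ?_
  change _ ≤ C * (2 + ‖x₀‖) ^ k * (1 + ‖p‖) ^ k
  rw [mul_assoc]
  refine mul_le_mul_of_nonneg_left ((one_add_norm_prod_pow_le x p k).trans ?_) hC0
  have := norm_le_of_mem_closedBall hx
  exact mul_le_mul_of_nonneg_right
    (pow_le_pow_left₀ (by positivity) (by linarith) k) (by positivity)

theorem Function.HasTemperateGrowth.paramFDeriv (h : H.HasTemperateGrowth) :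
    (paramFDeriv H).HasTemperateGrowth := by
  refine ⟨contDiff_paramFDeriv h.1, fun n => ?_⟩
  obtain ⟨C, hC, hb⟩ := exists_norm_iteratedFDeriv_paramFDeriv_le h.1 n
  obtain ⟨k, C', h'⟩ := h.2 (n + 1)
  refine ⟨k, C * C', fun z => (hb z).trans ?_⟩
  rw [mul_assoc]
  exact mul_le_mul_of_nonneg_left (h' z) hC

/-- A polynomial bound in `(x, p)` splits into a power of `1 + ‖x‖` times a power of `1 + ‖p‖`, and
the latter is integrable. Higher derivatives pass under the integral, again at the price of a
varying target space. -/
theorem HasMoments.norm_iteratedFDeriv_integral_le (hν : HasMoments ν) (n : ℕ) :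
    ∀ {F : Type} [NormedAddCommGroup F] [NormedSpace ℝ F] {H : X × P → F},
      H.HasTemperateGrowth → ∃ (k : ℕ) (C : ℝ), ∀ x,
        ‖iteratedFDeriv ℝ n (fun x => ∫ p, H (x, p) ∂ν) x‖ ≤ C * (1 + ‖x‖) ^ k := by
  induction n with
  | zero =>
    intro F _ _ H h
    obtain ⟨k, C, hC0, hC⟩ := h.norm_iteratedFDeriv_le_uniform 0
    refine ⟨k, C * ∫ p, (1 + ‖p‖) ^ k ∂ν, fun x => ?_⟩
    rw [norm_iteratedFDeriv_zero]
    calc ‖∫ p, H (x, p) ∂ν‖ ≤ ∫ p, C * (1 + ‖x‖) ^ k * (1 + ‖p‖) ^ k ∂ν := by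
          refine norm_integral_le_of_norm_le ((hν k).const_mul _)
            (Eventually.of_forall fun p => ?_)
          have := hC 0 le_rfl (x, p)
          rw [norm_iteratedFDeriv_zero] at this
          rw [mul_assoc]
          exact this.trans (mul_le_mul_of_nonneg_left (one_add_norm_prod_pow_le x p k) hC0)
      _ = _ := by rw [integral_const_mul]; ring
  | succ n ih =>
    intro F _ _ H h
    obtain ⟨k, C, hC⟩ := ih h.paramFDeriv
    refine ⟨k, C, fun x => ?_⟩
    rw [← norm_iteratedFDeriv_fderiv, (h.smoothDominated hν).fderiv_integral]
    exact hC x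

theorem HasMoments.hasTemperateGrowth_integral (hν : HasMoments ν) (h : H.HasTemperateGrowth) :
    (fun x => ∫ p, H (x, p) ∂ν).HasTemperateGrowth :=
  ⟨(h.smoothDominated hν).contDiff_integral, fun n => hν.norm_iteratedFDeriv_integral_le n h⟩

end Parametric

/-! ### Calculus of directional derivatives. -/

section DirectionalDerivative

variable {E E' : Type} [NormedAddCommGroup E] [NormedSpace ℝ E]
  [NormedAddCommGroup E'] [NormedSpace ℝ E'] {f g : E → ℝ}

/-- The derivative of `f` in the direction of the constant vector field `v`. -/
noncomputable def dirDeriv (v : E) (f : E → ℝ) : E → ℝ := fun x => fderiv ℝ f x v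

theorem pd_eq_dirDeriv (α : Fin 4) (f : Spacetime → ℝ) : pd α f = dirDeriv (coordVec α) f := rfl

theorem spd_eq_dirDeriv (i : Fin 3) (f : Space → ℝ) :
    spd i f = dirDeriv (EuclideanSpace.single i (1 : ℝ)) f := rfl

theorem contDiff_dirDeriv (h : ContDiff ℝ ∞ f) (v : E) : ContDiff ℝ ∞ (dirDeriv v f) :=
  (h.fderiv_right (m := ∞) (by simp)).clm_apply contDiff_const

theorem ContDiff.hasFDerivAt_fderiv (h : ContDiff ℝ ∞ f) (x : E) :
    HasFDerivAt f (fderiv ℝ f x) x := (h.differentiable (by simp) x).hasFDerivAt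

theorem HasFDerivAt.dirDeriv_eq {f' : E →L[ℝ] ℝ} {x : E} (h : HasFDerivAt f f' x) (v : E) :
    dirDeriv v f x = f' v := by rw [dirDeriv, h.fderiv]

theorem hasTemperateGrowth_dirDeriv (h : f.HasTemperateGrowth) (v : E) :
    (dirDeriv v f).HasTemperateGrowth := by
  have h' : (fderiv ℝ f).HasTemperateGrowth := by
    refine ⟨h.1.fderiv_right (by simp), fun n => ?_⟩
    obtain ⟨k, C, hC⟩ := h.2 (n + 1)
    exact ⟨k, C, fun x => by rw [norm_iteratedFDeriv_fderiv]; exact hC x⟩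
  exact (ContinuousLinearMap.apply ℝ ℝ v).hasTemperateGrowth.comp h'

theorem dirDeriv_comm (h : ContDiff ℝ ∞ f) (v w : E) :
    dirDeriv v (dirDeriv w f) = dirDeriv w (dirDeriv v f) := by
  have key : ∀ (v w x : E), dirDeriv v (dirDeriv w f) x = fderiv ℝ (fderiv ℝ f) x v w := by
    intro v w x
    have h2 : HasFDerivAt (fderiv ℝ f) (fderiv ℝ (fderiv ℝ f) x) x :=
      ((h.fderiv_right (m := ∞) (by simp)).differentiable (by simp) x).hasFDerivAt
    exact ((ContinuousLinearMap.apply ℝ ℝ w).hasFDerivAt.comp x h2).dirDeriv_eq v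
  ext x
  rw [key, key]
  exact (h.contDiffAt.isSymmSndFDerivAt
    (by simpa using WithTop.coe_le_coe.2 (le_top (a := (2 : ℕ∞))))).eq v w

theorem dirDeriv_add (hf : ContDiff ℝ ∞ f) (hg : ContDiff ℝ ∞ g) (v : E) :
    dirDeriv v (fun x => f x + g x) = fun x => dirDeriv v f x + dirDeriv v g x :=
  funext fun x => ((hf.hasFDerivAt_fderiv x).add (hg.hasFDerivAt_fderiv x)).dirDeriv_eq v

theorem dirDeriv_sub (hf : ContDiff ℝ ∞ f) (hg : ContDiff ℝ ∞ g) (v : E) :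
    dirDeriv v (fun x => f x - g x) = fun x => dirDeriv v f x - dirDeriv v g x :=
  funext fun x => ((hf.hasFDerivAt_fderiv x).sub (hg.hasFDerivAt_fderiv x)).dirDeriv_eq v

theorem dirDeriv_const_mul (hf : ContDiff ℝ ∞ f) (c : ℝ) (v : E) :
    dirDeriv v (fun x => c * f x) = fun x => c * dirDeriv v f x :=
  funext fun x => ((hf.hasFDerivAt_fderiv x).const_mul c).dirDeriv_eq v

theorem dirDeriv_mul (hf : ContDiff ℝ ∞ f) (hg : ContDiff ℝ ∞ g) (v : E) :
    dirDeriv v (fun x => f x * g x) = fun x => f x * dirDeriv v g x + g x * dirDeriv v f x :=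
  funext fun x => ((hf.hasFDerivAt_fderiv x).mul (hg.hasFDerivAt_fderiv x)).dirDeriv_eq v

theorem dirDeriv_sum {ι : Type} {s : Finset ι} {f : ι → E → ℝ}
    (hf : ∀ i ∈ s, ContDiff ℝ ∞ (f i)) (v : E) :
    dirDeriv v (fun x => ∑ i ∈ s, f i x) = fun x => ∑ i ∈ s, dirDeriv v (f i) x := by
  funext x
  rw [(HasFDerivAt.fun_sum fun i hi => (hf i hi).hasFDerivAt_fderiv x).dirDeriv_eq v]
  simp [dirDeriv]

theorem dirDeriv_const (c : ℝ) (v : E) : dirDeriv v (fun _ => c) = fun _ => 0 := by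
  funext x
  simp [dirDeriv]

theorem dirDeriv_clm (ℓ : E →L[ℝ] ℝ) (v : E) : dirDeriv v (fun x => ℓ x) = fun _ => ℓ v :=
  funext fun _ => ℓ.hasFDerivAt.dirDeriv_eq v

theorem dirDeriv_comp_add_clm {f : E' → ℝ} (hf : ContDiff ℝ ∞ f) (c : E') (L : E →L[ℝ] E')
    (v : E) : dirDeriv v (fun x => f (c + L x)) = fun x => dirDeriv (L v) f (c + L x) :=
  funext fun x => ((hf.hasFDerivAt_fderiv (c + L x)).comp x
    (L.hasFDerivAt.const_add c)).dirDeriv_eq v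

theorem dirDeriv_comp_clm {f : E' → ℝ} (hf : ContDiff ℝ ∞ f) (L : E →L[ℝ] E')
    (v : E) : dirDeriv v (fun x => f (L x)) = fun x => dirDeriv (L v) f (L x) :=
  funext fun x => ((hf.hasFDerivAt_fderiv (L x)).comp x L.hasFDerivAt).dirDeriv_eq v

theorem dirDeriv_sum_smul {ι : Type} (s : Finset ι) (c : ι → ℝ) (v : ι → E) (f : E → ℝ) (x : E) :
    dirDeriv (∑ i ∈ s, c i • v i) f x = ∑ i ∈ s, c i * dirDeriv (v i) f x := by
  simp [dirDeriv]

theorem ContDiff.hasDerivAt_line (hf : ContDiff ℝ ∞ f) (x v : E) (s : ℝ) :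
    HasDerivAt (fun s : ℝ => f (x + s • v)) (dirDeriv v f (x + s • v)) s := by
  have h : HasDerivAt (fun s : ℝ => x + s • v) v s := by
    simpa using ((hasDerivAt_id s).smul_const v).const_add x
  exact (hf.hasFDerivAt_fderiv _).comp_hasDerivAt s h

theorem HasDerivAt.dirDeriv_eq (hf : ContDiff ℝ ∞ f) {x v : E} {d : ℝ}
    (h : HasDerivAt (fun s : ℝ => f (x + s • v)) d 0) : dirDeriv v f x = d := by
  have := (hf.hasDerivAt_line x v 0).unique h
  simpa using this

end DirectionalDerivative

/-! ### The invariant measure on the unit sphere and its infinitesimal symmetry. -/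

section SphereMeasure

variable (V : Type) [NormedAddCommGroup V] [InnerProductSpace ℝ V] [FiniteDimensional ℝ V]
  [MeasurableSpace V] [BorelSpace V]

/-- The rotation invariant probability measure on the unit sphere of `V`. -/
noncomputable def sphereMeasure : Measure V :=
  (ProbabilityTheory.cond volume (Metric.ball (0 : V) 1)).map fun y => ‖y‖⁻¹ • y

theorem measurable_normalize : Measurable fun y : V => ‖y‖⁻¹ • y := by fun_prop

theorem isProbabilityMeasure_cond_ball :
    IsProbabilityMeasure (ProbabilityTheory.cond volume (Metric.ball (0 : V) 1)) :=
  ProbabilityTheory.cond_isProbabilityMeasure_of_finite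
    (Metric.measure_ball_pos volume (0 : V) one_pos).ne' measure_ball_lt_top.ne

instance : IsProbabilityMeasure (sphereMeasure V) :=
  have := isProbabilityMeasure_cond_ball V
  Measure.isProbabilityMeasure_map (measurable_normalize V).aemeasurable

theorem ae_norm_eq_one_sphereMeasure [Nontrivial V] : ∀ᵐ η ∂sphereMeasure V, ‖η‖ = 1 := by
  rw [sphereMeasure, ae_map_iff (measurable_normalize V).aemeasurable
    (measurableSet_eq_fun measurable_norm measurable_const)]
  refine (ProbabilityTheory.cond_absolutelyContinuous (μ := volume)).ae_le ?_
  filter_upwards [compl_mem_ae_iff.2 (measure_singleton (μ := (volume : Measure V)) 0)] with y hy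
  have : ‖y‖ ≠ 0 := norm_ne_zero_iff.2 hy
  rw [norm_smul, norm_inv, norm_norm, inv_mul_cancel₀ this]

/-- A linear isometry preserves volume and the unit ball, and commutes with `y ↦ ‖y‖⁻¹ • y`. -/
theorem measurePreserving_sphereMeasure (R : V ≃ₗᵢ[ℝ] V) :
    MeasurePreserving R (sphereMeasure V) (sphereMeasure V) := by
  have h : MeasurePreserving R (ProbabilityTheory.cond volume (Metric.ball (0 : V) 1))
      (ProbabilityTheory.cond volume (Metric.ball (0 : V) 1)) := by
    have h := R.measurePreserving.restrict_preimage (s := Metric.ball (0 : V) 1) measurableSet_ball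
    rw [show R ⁻¹' Metric.ball (0 : V) 1 = Metric.ball 0 1 by ext; simp] at h
    exact h.smul_measure _
  refine ⟨R.continuous.measurable, ?_⟩
  rw [sphereMeasure, Measure.map_map R.continuous.measurable (measurable_normalize V)]
  conv_rhs => rw [← h.map_eq, Measure.map_map (measurable_normalize V) R.continuous.measurable]
  congr 1
  ext y
  simp

theorem Continuous.integrable_sphereMeasure [Nontrivial V] {f : V → ℝ} (hf : Continuous f) :
    Integrable f (sphereMeasure V) := by
  obtain ⟨C, hC⟩ := (isCompact_sphere (0 : V) 1).exists_bound_of_continuousOn hf.continuousOn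
  refine (integrable_const C).mono' hf.aestronglyMeasurable ?_
  filter_upwards [ae_norm_eq_one_sphereMeasure V] with η h
  exact hC η (by simpa using h)

theorem hasMoments_sphereMeasure [Nontrivial V] : HasMoments (sphereMeasure V) := fun k =>
  Continuous.integrable_sphereMeasure V (by fun_prop)

theorem smoothDominated_sphereMeasure [Nontrivial V] {X F : Type} [NormedAddCommGroup X]
    [NormedSpace ℝ X] [FiniteDimensional ℝ X] [NormedAddCommGroup F] [NormedSpace ℝ F]
    {H : X × V → F} (h : ContDiff ℝ ∞ H) : SmoothDominated (sphereMeasure V) H := by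
  refine smoothDominated_of_compact (isCompact_sphere (0 : V) 1) ?_ h
  filter_upwards [ae_norm_eq_one_sphereMeasure V] with η h
  simpa using h

variable {V}

theorem reflection_orthogonal_unit {v : V} (hv : ‖v‖ = 1) (y : V) :
    (ℝ ∙ v)ᗮ.reflection y = y - (2 * inner ℝ v y) • v := by
  rw [Submodule.reflection_orthogonal_apply, Submodule.reflection_singleton_apply, hv]
  simp [two_smul, two_mul, add_smul]

/-- Infinitesimal rotation invariance of the measure on the sphere. -/
theorem integral_rotation_sphereMeasure [Nontrivial V] {k : V → ℝ} (hk : ContDiff ℝ ∞ k)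
    {e e' : V} (he : ‖e‖ = 1) (he' : ‖e'‖ = 1) (hee' : inner ℝ e e' = 0) :
    ∫ η, (inner ℝ e η * dirDeriv e' k η - inner ℝ e' η * dirDeriv e k η) ∂sphereMeasure V = 0 := by
  -- Instead of rotations, the reflections along the unit vector `v θ` turning from `e` towards `e'`
  -- are used. Each preserves the measure, so the integral of `k` composed with them does not depend
  -- on `θ`; its derivative at `θ = 0` is the claim.
  let v : ℝ → V := fun θ => Real.cos θ • e + Real.sin θ • e'
  have hv : ∀ θ, ‖v θ‖ = 1 := by
    intro θ
    have : ‖v θ‖ ^ 2 = 1 := by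
      rw [← real_inner_self_eq_norm_sq]
      simp only [v, inner_add_left, inner_add_right, inner_smul_left, inner_smul_right,
        real_inner_self_eq_norm_sq, he, he', hee', real_inner_comm e e']
      simp
      nlinarith [Real.sin_sq_add_cos_sq θ]
    nlinarith [norm_nonneg (v θ)]
  have hvs : ContDiff ℝ ∞ v := by
    have := Real.contDiff_cos (n := ∞)
    have := Real.contDiff_sin (n := ∞)
    fun_prop
  let H : ℝ × V → ℝ := fun q => k (q.2 - (2 * inner ℝ (v q.1) q.2) • v q.1)
  have hHs : ContDiff ℝ ∞ H := by
    refine hk.comp (contDiff_snd.sub (ContDiff.smul (contDiff_const.mul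
      (ContDiff.inner ℝ (hvs.comp contDiff_fst) contDiff_snd)) (hvs.comp contDiff_fst)))
  have hconst : (fun θ => ∫ η, H (θ, η) ∂sphereMeasure V) = fun _ => ∫ η, k η ∂sphereMeasure V := by
    funext θ
    have := (measurePreserving_sphereMeasure V (ℝ ∙ v θ)ᗮ.reflection).integral_comp
      (ℝ ∙ v θ)ᗮ.reflection.toHomeomorph.measurableEmbedding k
    simpa only [reflection_orthogonal_unit (hv θ)] using this
  have hd := (smoothDominated_sphereMeasure V hHs).fderiv_integral_apply 0 (1 : ℝ)
  rw [hconst] at hd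
  -- The derivative is expressed at the reflected point, whose inner product with `e` has changed
  -- sign. A further use of invariance then removes the reflection.
  have hpt : ∀ η : V, fderiv ℝ H (0, η) ((1 : ℝ), (0 : V)) =
      (fun z : V => 2 * (inner ℝ e z * dirDeriv e' k z - inner ℝ e' z * dirDeriv e k z))
        ((ℝ ∙ e)ᗮ.reflection η) := by
    intro η
    change dirDeriv ((1 : ℝ), (0 : V)) H (0, η) = _
    have hvd : HasDerivAt v e' 0 := by
      have := ((Real.hasDerivAt_cos 0).smul_const e).add ((Real.hasDerivAt_sin 0).smul_const e')
      simpa [v, Pi.add_def] using this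
    have hv0 : v 0 = e := by simp [v]
    have hin : HasDerivAt (fun θ => 2 * inner ℝ (v θ) η) (2 * inner ℝ e' η) 0 := by
      have := (hvd.inner ℝ (hasDerivAt_const (0 : ℝ) η)).const_mul 2
      simpa using this
    have hcur := (hin.smul hvd).const_sub η
    have hkd := (hk.hasFDerivAt_fderiv (η - (2 * inner ℝ (v 0) η) • v 0)).comp_hasDerivAt 0 hcur
    refine HasDerivAt.dirDeriv_eq hHs ?_
    simp only [reflection_orthogonal_unit he]
    have hline : (fun s : ℝ => H ((0, η) + s • ((1 : ℝ), (0 : V)))) =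
        k ∘ fun s => η - ((fun θ => 2 * inner ℝ (v θ) η) • v) s := by
      funext s
      simp [H]
    rw [hline]
    refine hkd.congr_deriv ?_
    rw [hv0]
    simp only [dirDeriv, inner_sub_right, inner_smul_right, real_inner_self_eq_norm_sq, he,
      real_inner_comm e e', hee', map_neg, map_add, map_smul, smul_eq_mul]
    ring
  simp only [hpt] at hd
  rw [(measurePreserving_sphereMeasure V (ℝ ∙ e)ᗮ.reflection).integral_comp
      (ℝ ∙ e)ᗮ.reflection.toHomeomorph.measurableEmbedding
      (fun z : V => 2 * (inner ℝ e z * dirDeriv e' k z - inner ℝ e' z * dirDeriv e k z)),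
    integral_const_mul] at hd
  simp at hd
  linarith

end SphereMeasure

/-! ### Spherical means and the Euler-Poisson-Darboux equation. -/

/-- Five-dimensional Euclidean space, the lowest dimension in which the wave equation can be
solved by spherical means and from which the massive equation in three dimensions descends. -/
abbrev FiveSpace : Type := EuclideanSpace ℝ (Fin 5)

section SphericalMean

variable {E : Type} [NormedAddCommGroup E] [NormedSpace ℝ E] {f g : E → ℝ}
  (L : FiveSpace →L[ℝ] E) {w : FiveSpace → ℝ}

/-- The image under `L` of a standard basis vector. -/
noncomputable def frameVec (j : Fin 5) : E := L (EuclideanSpace.single j 1)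

theorem clm_eq_sum_frameVec (η : FiveSpace) : L η = ∑ j, η j • frameVec L j := by
  have h : η = ∑ j, η j • (EuclideanSpace.single j (1 : ℝ) : FiveSpace) := by
    ext i
    simp [Finset.sum_apply, Pi.single_apply]
  conv_lhs => rw [h]
  simp [frameVec]

/-- The sum of the second derivatives along the images of the standard basis vectors. -/
noncomputable def frameLaplacian (f : E → ℝ) : E → ℝ :=
  fun x => ∑ j, dirDeriv (frameVec L j) (dirDeriv (frameVec L j) f) x

/-- The weighted mean of `f` over the image of the sphere of radius `t` about `x`. -/
noncomputable def weightedMean (w : FiveSpace → ℝ) (f : E → ℝ) : ℝ × E → ℝ :=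
  fun q => ∫ η, w η * f (q.2 + q.1 • L η) ∂sphereMeasure FiveSpace

/-- The integrand of `weightedMean`. -/
noncomputable def meanIntegrand (w : FiveSpace → ℝ) (f : E → ℝ) : (ℝ × E) × FiveSpace → ℝ :=
  fun z => w z.2 * f (z.1.2 + z.1.1 • L z.2)

theorem contDiff_meanIntegrand (hw : ContDiff ℝ ∞ w) (hf : ContDiff ℝ ∞ f) :
    ContDiff ℝ ∞ (meanIntegrand L w f) := by
  unfold meanIntegrand
  fun_prop

theorem hasTemperateGrowth_meanIntegrand (hw : w.HasTemperateGrowth) (hf : f.HasTemperateGrowth) :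
    (meanIntegrand L w f).HasTemperateGrowth := by
  have h1 : (fun z : (ℝ × E) × FiveSpace => z.2).HasTemperateGrowth :=
    (ContinuousLinearMap.snd ℝ (ℝ × E) FiveSpace).hasTemperateGrowth
  have h2 : (fun z : (ℝ × E) × FiveSpace => z.1.1).HasTemperateGrowth :=
    ((ContinuousLinearMap.fst ℝ ℝ E).comp
      (ContinuousLinearMap.fst ℝ (ℝ × E) FiveSpace)).hasTemperateGrowth
  have h3 : (fun z : (ℝ × E) × FiveSpace => z.1.2).HasTemperateGrowth :=
    ((ContinuousLinearMap.snd ℝ ℝ E).comp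
      (ContinuousLinearMap.fst ℝ (ℝ × E) FiveSpace)).hasTemperateGrowth
  have h4 : (fun z : (ℝ × E) × FiveSpace => L z.2).HasTemperateGrowth :=
    L.hasTemperateGrowth.comp h1
  exact (hw.comp h1).mul (hf.comp (h3.add (h2.smul h4)))

theorem hasTemperateGrowth_weightedMean (hw : w.HasTemperateGrowth)
    (hf : f.HasTemperateGrowth) : (weightedMean L w f).HasTemperateGrowth :=
  (hasMoments_sphereMeasure FiveSpace).hasTemperateGrowth_integral
    (hasTemperateGrowth_meanIntegrand L hw hf)

theorem fderiv_meanIntegrand (hw : ContDiff ℝ ∞ w) (hf : ContDiff ℝ ∞ f) (q : ℝ × E)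
    (η : FiveSpace) (v : ℝ × E) : fderiv ℝ (meanIntegrand L w f) (q, η) (v, 0) =
      w η * dirDeriv (v.2 + v.1 • L η) f (q.2 + q.1 • L η) := by
  refine HasDerivAt.dirDeriv_eq (contDiff_meanIntegrand L hw hf) ?_
  have h := ((hf.hasDerivAt_line (q.2 + q.1 • L η) (v.2 + v.1 • L η) 0).const_mul (w η))
  simp only [zero_smul, add_zero] at h
  refine h.congr_of_eventuallyEq (Eventually.of_forall fun s => ?_)
  simp only [meanIntegrand, Prod.mk_add_mk, Prod.smul_mk, Prod.fst_add, Prod.snd_add,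
    Prod.smul_fst, Prod.smul_snd, smul_zero, add_zero, smul_eq_mul]
  congr 2
  module

variable [FiniteDimensional ℝ E]

theorem smoothDominated_meanIntegrand (hw : ContDiff ℝ ∞ w) (hf : ContDiff ℝ ∞ f) :
    SmoothDominated (sphereMeasure FiveSpace) (meanIntegrand L w f) :=
  smoothDominated_sphereMeasure FiveSpace (contDiff_meanIntegrand L hw hf)

theorem contDiff_weightedMean (hw : ContDiff ℝ ∞ w) (hf : ContDiff ℝ ∞ f) :
    ContDiff ℝ ∞ (weightedMean L w f) :=
  (smoothDominated_meanIntegrand L hw hf).contDiff_integral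

theorem dirDeriv_snd_weightedMean (hw : ContDiff ℝ ∞ w) (hf : ContDiff ℝ ∞ f) (v : E) :
    dirDeriv (0, v) (weightedMean L w f) = weightedMean L w (dirDeriv v f) := by
  funext q
  refine ((smoothDominated_meanIntegrand L hw hf).fderiv_integral_apply q (0, v)).trans ?_
  simp only [fderiv_meanIntegrand L hw hf, weightedMean, zero_smul, add_zero]

theorem integrable_meanIntegrand (hw : ContDiff ℝ ∞ w) (hf : ContDiff ℝ ∞ f) (q : ℝ × E) :
    Integrable (fun η => w η * f (q.2 + q.1 • L η)) (sphereMeasure FiveSpace) :=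
  (smoothDominated_meanIntegrand L hw hf).integrable q

theorem dirDeriv_fst_weightedMean (hw : ContDiff ℝ ∞ w) (hf : ContDiff ℝ ∞ f) :
    dirDeriv ((1 : ℝ), (0 : E)) (weightedMean L w f) =
      fun q => ∑ j, weightedMean L (fun η => w η * η j) (dirDeriv (frameVec L j) f) q := by
  funext q
  refine ((smoothDominated_meanIntegrand L hw hf).fderiv_integral_apply q (1, 0)).trans ?_
  simp only [fderiv_meanIntegrand L hw hf, weightedMean, one_smul, zero_add]
  rw [← integral_finsetSum]
  · refine integral_congr_ae (Eventually.of_forall fun η => ?_)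
    simp only
    rw [clm_eq_sum_frameVec L η, dirDeriv_sum_smul, Finset.mul_sum]
    simp only [mul_assoc]
  · intro j _
    exact integrable_meanIntegrand L (by fun_prop) (contDiff_dirDeriv hf _) q

theorem weightedMean_sub (hw : ContDiff ℝ ∞ w) (hf : ContDiff ℝ ∞ f) (hg : ContDiff ℝ ∞ g) :
    weightedMean L w (fun x => f x - g x) =
      fun q => weightedMean L w f q - weightedMean L w g q := by
  funext q
  simp only [weightedMean, mul_sub]
  exact integral_sub (integrable_meanIntegrand L hw hf q) (integrable_meanIntegrand L hw hg q)

theorem weightedMean_const_mul (c : ℝ) : weightedMean L w (fun x => c * f x) =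
    fun q => c * weightedMean L w f q := by
  funext q
  simp only [weightedMean, mul_left_comm _ c, integral_const_mul]

theorem weightedMean_sum {ι : Type} {s : Finset ι} {f : ι → E → ℝ} (hw : ContDiff ℝ ∞ w)
    (hf : ∀ i ∈ s, ContDiff ℝ ∞ (f i)) : weightedMean L w (fun x => ∑ i ∈ s, f i x) =
      fun q => ∑ i ∈ s, weightedMean L w (f i) q := by
  funext q
  simp only [weightedMean, Finset.mul_sum]
  exact integral_finsetSum s fun i hi => integrable_meanIntegrand L hw (hf i hi) q

/-- Spherical mean, in the variables radius and centre. -/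
noncomputable def sphericalMean (f : E → ℝ) : ℝ × E → ℝ := weightedMean L (fun _ => 1) f

theorem integral_lincomb_five {α : Type} [MeasurableSpace α] {ν : Measure α}
    {f₁ f₂ f₃ f₄ f₅ : α → ℝ} (a : ℝ) (h₁ : Integrable f₁ ν) (h₂ : Integrable f₂ ν)
    (h₃ : Integrable f₃ ν) (h₄ : Integrable f₄ ν) (h₅ : Integrable f₅ ν) :
    ∫ x, (a * f₁ x + a * f₂ x - 2 * (a * f₃ x) - f₄ x - f₅ x) ∂ν =
      a * ∫ x, f₁ x ∂ν + a * ∫ x, f₂ x ∂ν - 2 * (a * ∫ x, f₃ x ∂ν) - ∫ x, f₄ x ∂ν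
        - ∫ x, f₅ x ∂ν := by
  have e₁ : Integrable (fun x => a * f₁ x) ν := h₁.const_mul a
  have e₂ : Integrable (fun x => a * f₂ x) ν := h₂.const_mul a
  have e₃ : Integrable (fun x => 2 * (a * f₃ x)) ν := (h₃.const_mul a).const_mul 2
  have e₁₂ : Integrable (fun x => a * f₁ x + a * f₂ x) ν := e₁.add e₂
  have e₁₃ : Integrable (fun x => a * f₁ x + a * f₂ x - 2 * (a * f₃ x)) ν := e₁₂.sub e₃
  have e₁₄ : Integrable (fun x => a * f₁ x + a * f₂ x - 2 * (a * f₃ x) - f₄ x) ν := e₁₃.sub h₄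
  rw [integral_sub e₁₄ h₅, integral_sub e₁₃ h₄, integral_sub e₁₂ e₃, integral_add e₁ e₂]
  simp only [integral_const_mul]

/-- For `i ≠ j` this is infinitesimal rotation invariance in the `(i, j)` plane applied to `η_i ∂_j
f - η_j ∂_i f`, that is, the mean of the square of the angular derivative. The value at `i = j` is
recorded so that the identity can be summed over all pairs. -/
theorem rotation_weightedMean (hf : ContDiff ℝ ∞ f) (q : ℝ × E) (i j : Fin 5) :
    q.1 * weightedMean L (fun η => η i * η i)
        (dirDeriv (frameVec L j) (dirDeriv (frameVec L j) f)) q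
      + q.1 * weightedMean L (fun η => η j * η j)
        (dirDeriv (frameVec L i) (dirDeriv (frameVec L i) f)) q
      - 2 * (q.1 * weightedMean L (fun η => η j * η i)
        (dirDeriv (frameVec L i) (dirDeriv (frameVec L j) f)) q)
      - weightedMean L (fun η => η i) (dirDeriv (frameVec L i) f) q
      - weightedMean L (fun η => η j) (dirDeriv (frameVec L j) f) q
      = if i = j then -2 * weightedMean L (fun η => η i) (dirDeriv (frameVec L i) f) q else 0 := by
  split_ifs with hij
  · subst hij
    ring
  · have hfi := contDiff_dirDeriv hf (frameVec L i)
    have hfj := contDiff_dirDeriv hf (frameVec L j)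
    have hfii := contDiff_dirDeriv hfi (frameVec L i)
    have hfij := contDiff_dirDeriv hfj (frameVec L i)
    have hfjj := contDiff_dirDeriv hfj (frameVec L j)
    let ψ : (E → ℝ) → FiveSpace → ℝ := fun h η => h (q.2 + (q.1 • L) η)
    have hψ : ∀ {h : E → ℝ}, ContDiff ℝ ∞ h → ContDiff ℝ ∞ (ψ h) := by
      intro h hh
      simp only [ψ]
      fun_prop
    have hd : ∀ (l : Fin 5) {h : E → ℝ}, ContDiff ℝ ∞ h → ∀ η,
        dirDeriv (EuclideanSpace.single l (1 : ℝ)) (ψ h) η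
          = q.1 * ψ (dirDeriv (frameVec L l) h) η := by
      intro l h hh η
      simp only [ψ]
      rw [dirDeriv_comp_add_clm hh]
      simp [dirDeriv, frameVec]
    have hc : ∀ l m : Fin 5, dirDeriv (EuclideanSpace.single l (1 : ℝ))
        (fun η : FiveSpace => η m) = fun _ => if l = m then (1 : ℝ) else 0 := by
      intro l m
      refine (dirDeriv_clm (EuclideanSpace.proj m : FiveSpace →L[ℝ] ℝ) _).trans ?_
      funext _
      simp [eq_comm]
    have hp : ∀ m : Fin 5, ContDiff ℝ ∞ (fun η : FiveSpace => η m) := fun m => by fun_prop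
    let k : FiveSpace → ℝ := fun η =>
      η i * ψ (dirDeriv (frameVec L j) f) η - η j * ψ (dirDeriv (frameVec L i) f) η
    have hk : ContDiff ℝ ∞ k := ((hp i).mul (hψ hfj)).sub ((hp j).mul (hψ hfi))
    have hdk : ∀ l η, dirDeriv (EuclideanSpace.single l (1 : ℝ)) k η =
        (η i * (q.1 * ψ (dirDeriv (frameVec L l) (dirDeriv (frameVec L j) f)) η)
          + ψ (dirDeriv (frameVec L j) f) η * (if l = i then 1 else 0))
        - (η j * (q.1 * ψ (dirDeriv (frameVec L l) (dirDeriv (frameVec L i) f)) η)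
          + ψ (dirDeriv (frameVec L i) f) η * (if l = j then 1 else 0)) := by
      intro l η
      simp only [k]
      rw [dirDeriv_sub ((hp i).mul (hψ hfj)) ((hp j).mul (hψ hfi)), dirDeriv_mul (hp i) (hψ hfj),
        dirDeriv_mul (hp j) (hψ hfi)]
      simp only [hc, hd l hfi, hd l hfj]
    have hrot := integral_rotation_sphereMeasure hk
      (e := EuclideanSpace.single i (1 : ℝ)) (e' := EuclideanSpace.single j (1 : ℝ))
      (by simp) (by simp) (by simp [EuclideanSpace.inner_single_left, hij])
    have hji : j ≠ i := fun h => hij h.symm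
    simp only [hdk, hij, hji, if_true, if_false, EuclideanSpace.inner_single_left, map_one, one_mul,
      mul_zero, add_zero, mul_one] at hrot
    have I1 := integrable_meanIntegrand L (w := fun η => η i * η i) (by fun_prop) hfjj q
    have I2 := integrable_meanIntegrand L (w := fun η => η j * η j) (by fun_prop) hfii q
    have I3 := integrable_meanIntegrand L (w := fun η => η j * η i) (by fun_prop) hfij q
    have I4 := integrable_meanIntegrand L (w := fun η => η i) (by fun_prop) hfi q
    have I5 := integrable_meanIntegrand L (w := fun η => η j) (by fun_prop) hfj q
    simp only [weightedMean]
    rw [← integral_lincomb_five q.1 I1 I2 I3 I4 I5, ← hrot]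
    refine integral_congr_ae (Eventually.of_forall fun η => ?_)
    simp only [ψ, dirDeriv_comm hf (frameVec L j) (frameVec L i), smul_apply]
    ring

theorem contDiff_sphericalMean (hf : ContDiff ℝ ∞ f) : ContDiff ℝ ∞ (sphericalMean L f) :=
  contDiff_weightedMean L contDiff_const hf

theorem contDiff_frameLaplacian (hf : ContDiff ℝ ∞ f) : ContDiff ℝ ∞ (frameLaplacian L f) :=
  ContDiff.sum fun _ _ => contDiff_dirDeriv (contDiff_dirDeriv hf _) _

/-- The Euler-Poisson-Darboux equation for spherical means in five dimensions. -/
theorem sphericalMean_darboux (hf : ContDiff ℝ ∞ f) (q : ℝ × E) :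
    q.1 * sphericalMean L (frameLaplacian L f) q =
      q.1 * dirDeriv ((1 : ℝ), (0 : E)) (dirDeriv ((1 : ℝ), (0 : E)) (sphericalMean L f)) q
        + 4 * dirDeriv ((1 : ℝ), (0 : E)) (sphericalMean L f) q := by
  have h1 := contDiff_const (𝕜 := ℝ) (E := FiveSpace) (n := ∞) (c := (1 : ℝ))
  have hp : ∀ m : Fin 5, ContDiff ℝ ∞ (fun η : FiveSpace => (1 : ℝ) * η m) := fun m => by fun_prop
  have hD := fun j => contDiff_dirDeriv hf (frameVec L j)
  have e1 : dirDeriv ((1 : ℝ), (0 : E)) (sphericalMean L f) =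
      fun q => ∑ j, weightedMean L (fun η => 1 * η j) (dirDeriv (frameVec L j) f) q :=
    dirDeriv_fst_weightedMean L h1 hf
  have e2 : dirDeriv ((1 : ℝ), (0 : E)) (dirDeriv ((1 : ℝ), (0 : E)) (sphericalMean L f)) =
      fun q => ∑ j, ∑ i, weightedMean L (fun η => 1 * η j * η i)
        (dirDeriv (frameVec L i) (dirDeriv (frameVec L j) f)) q := by
    rw [e1, dirDeriv_sum fun j _ => contDiff_weightedMean L (hp j) (hD j)]
    funext q
    exact Finset.sum_congr rfl fun j _ =>
      congrFun (dirDeriv_fst_weightedMean L (hp j) (hD j)) q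
  have e3 : sphericalMean L (frameLaplacian L f) q = ∑ j, ∑ i, weightedMean L
      (fun η => η i * η i) (dirDeriv (frameVec L j) (dirDeriv (frameVec L j) f)) q := by
    have : sphericalMean L (frameLaplacian L f) q = ∑ j, weightedMean L (fun _ => 1)
        (dirDeriv (frameVec L j) (dirDeriv (frameVec L j) f)) q :=
      congrFun (weightedMean_sum L h1 fun j _ => contDiff_dirDeriv (hD j) _) q
    rw [this]
    refine Finset.sum_congr rfl fun j _ => ?_
    simp only [weightedMean]
    rw [← integral_finsetSum]
    · refine integral_congr_ae ?_
      -- The weights `η_i ^ 2` add up to `1` on the sphere.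
      filter_upwards [ae_norm_eq_one_sphereMeasure FiveSpace] with η hη
      rw [← Finset.sum_mul]
      congr 1
      have := EuclideanSpace.real_norm_sq_eq η
      rw [hη] at this
      simpa [sq] using this
    · intro i _
      exact integrable_meanIntegrand L (by fun_prop) (contDiff_dirDeriv (hD j) _) q
  rw [e2, e1, e3]
  -- Writing `M` for the mean and `Δ` for the frame Laplacian, the sum over all pairs reads `2 t M(Δ
  -- f) - 2 t ∂_t² M - 10 ∂_t M = -2 ∂_t M`. The coefficient `4` is the dimension minus one.
  have hsum := Finset.sum_congr rfl fun (j : Fin 5) (_ : j ∈ Finset.univ) =>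
    Finset.sum_congr rfl fun (i : Fin 5) (_ : i ∈ Finset.univ) => rotation_weightedMean L hf q i j
  simp only [Finset.sum_sub_distrib, Finset.sum_add_distrib, ← Finset.mul_sum,
    Finset.sum_ite_eq', Finset.mem_univ, if_true, Finset.sum_const, Finset.card_univ,
    Fintype.card_fin, nsmul_eq_mul] at hsum
  rw [Finset.sum_comm (f := fun j i => weightedMean L (fun η => η j * η j)
    (dirDeriv (frameVec L i) (dirDeriv (frameVec L i) f)) q)] at hsum
  simp only [one_mul]
  push_cast at hsum
  linarith

end SphericalMean

/-! ### The wave equation in five dimensions. -/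

section WaveEquation

variable {E : Type} [NormedAddCommGroup E] [NormedSpace ℝ E] {f g : E → ℝ}
  (L : FiveSpace →L[ℝ] E)

/-- The derivative of a function of `(t, e)` with respect to `t`. -/
noncomputable def timeDeriv (h : ℝ × E → ℝ) : ℝ × E → ℝ := dirDeriv ((1 : ℝ), (0 : E)) h

theorem contDiff_timeDeriv {h : ℝ × E → ℝ} (hh : ContDiff ℝ ∞ h) : ContDiff ℝ ∞ (timeDeriv h) :=
  contDiff_dirDeriv hh _

theorem hasDerivAt_timeDeriv {h : ℝ × E → ℝ} (hh : ContDiff ℝ ∞ h) (t : ℝ) (e : E) :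
    HasDerivAt (fun s => h (s, e)) (timeDeriv h (t, e)) t := by
  have := hh.hasDerivAt_line ((0 : ℝ), e) ((1 : ℝ), (0 : E)) t
  simpa [timeDeriv] using this

theorem timeDeriv_eq_of_hasDerivAt {h : ℝ × E → ℝ} (hh : ContDiff ℝ ∞ h) {t d : ℝ} {e : E}
    (hd : HasDerivAt (fun s => h (s, e)) d t) : timeDeriv h (t, e) = d :=
  (hasDerivAt_timeDeriv hh t e).unique hd

theorem timeDeriv_eq_zero {h : ℝ × E → ℝ} (hh : ContDiff ℝ ∞ h) {e : E} (h0 : ∀ t, h (t, e) = 0)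
    (t : ℝ) : timeDeriv h (t, e) = 0 :=
  timeDeriv_eq_of_hasDerivAt hh (by simpa only [h0] using hasDerivAt_const t (0 : ℝ))

/-- The solution `U` of `∂ₜ² U = Δ U`, `U = 0` and `∂ₜ U = f` at `t = 0`, where `Δ` is the
Laplacian in the directions of the frame `L`. -/
noncomputable def waveSolution (f : E → ℝ) : ℝ × E → ℝ :=
  fun q => q.1 * sphericalMean L f q + q.1 ^ 2 / 3 * timeDeriv (sphericalMean L f) q

theorem hasTemperateGrowth_waveSolution (hf : f.HasTemperateGrowth) :
    (waveSolution L f).HasTemperateGrowth := by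
  have h1 : (fun q : ℝ × E => q.1).HasTemperateGrowth :=
    (ContinuousLinearMap.fst ℝ ℝ E).hasTemperateGrowth
  have h2 : (sphericalMean L f).HasTemperateGrowth :=
    hasTemperateGrowth_weightedMean L (.const 1) hf
  have h3 : (fun q : ℝ × E => q.1 ^ 2 / 3).HasTemperateGrowth := by
    simp only [div_eq_mul_inv]
    exact (h1.pow 2).mul (.const _)
  exact (h1.mul h2).add (h3.mul (hasTemperateGrowth_dirDeriv h2 _))

variable [FiniteDimensional ℝ E]

theorem contDiff_waveSolution (hf : ContDiff ℝ ∞ f) : ContDiff ℝ ∞ (waveSolution L f) := by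
  have h2 := contDiff_sphericalMean L hf
  have h3 := contDiff_timeDeriv h2
  unfold waveSolution
  fun_prop

/-- The Darboux equation, multiplied by `t / 3` so that it also holds at `t = 0`, eliminates the
second radial derivative; the coefficient of `∂_t M` becomes `t + 2t/3 - 4t/3 = t/3`. No second
derivative of `M` is left, so one more differentiation and one more use of Darboux give the wave
equation. -/
theorem timeDeriv_waveSolution (hf : ContDiff ℝ ∞ f) : timeDeriv (waveSolution L f) =
    fun q => sphericalMean L f q + q.1 / 3 * timeDeriv (sphericalMean L f) q
      + q.1 ^ 2 / 3 * sphericalMean L (frameLaplacian L f) q := by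
  funext ⟨t, e⟩
  have h2 := contDiff_sphericalMean L hf
  have h3 := contDiff_timeDeriv h2
  refine timeDeriv_eq_of_hasDerivAt (contDiff_waveSolution L hf) ?_
  have hd := ((hasDerivAt_id t).mul (hasDerivAt_timeDeriv h2 t e)).add
    ((((hasDerivAt_id t).pow 2).div_const 3).mul (hasDerivAt_timeDeriv h3 t e))
  refine hd.congr_deriv ?_
  have hD : t * sphericalMean L (frameLaplacian L f) (t, e) =
      t * timeDeriv (timeDeriv (sphericalMean L f)) (t, e)
        + 4 * timeDeriv (sphericalMean L f) (t, e) := sphericalMean_darboux L hf (t, e)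
  simp
  linear_combination (-t / 3) * hD

theorem timeDeriv_timeDeriv_waveSolution (hf : ContDiff ℝ ∞ f) :
    timeDeriv (timeDeriv (waveSolution L f)) = waveSolution L (frameLaplacian L f) := by
  funext ⟨t, e⟩
  have h2 := contDiff_sphericalMean L hf
  have h3 := contDiff_timeDeriv h2
  have h4 := contDiff_sphericalMean L (contDiff_frameLaplacian L hf)
  refine timeDeriv_eq_of_hasDerivAt (contDiff_timeDeriv (contDiff_waveSolution L hf)) ?_
  rw [timeDeriv_waveSolution L hf]
  have hd := ((hasDerivAt_timeDeriv h2 t e).add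
    (((hasDerivAt_id t).div_const 3).mul (hasDerivAt_timeDeriv h3 t e))).add
    ((((hasDerivAt_id t).pow 2).div_const 3).mul (hasDerivAt_timeDeriv h4 t e))
  refine hd.congr_deriv ?_
  have hD : t * sphericalMean L (frameLaplacian L f) (t, e) =
      t * timeDeriv (timeDeriv (sphericalMean L f)) (t, e)
        + 4 * timeDeriv (sphericalMean L f) (t, e) := sphericalMean_darboux L hf (t, e)
  simp [waveSolution]
  linear_combination (-1 / 3) * hD

theorem waveSolution_zero (f : E → ℝ) (e : E) : waveSolution L f (0, e) = 0 := by
  simp [waveSolution]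

theorem timeDeriv_waveSolution_zero (hf : ContDiff ℝ ∞ f) (e : E) :
    timeDeriv (waveSolution L f) (0, e) = f e := by
  rw [timeDeriv_waveSolution L hf]
  simp [sphericalMean, weightedMean]

theorem dirDeriv_snd_waveSolution (hf : ContDiff ℝ ∞ f) (v : E) :
    dirDeriv (0, v) (waveSolution L f) = waveSolution L (dirDeriv v f) := by
  have h2 := contDiff_sphericalMean L hf
  have h3 := contDiff_timeDeriv h2
  have hM : dirDeriv (0, v) (sphericalMean L f) = sphericalMean L (dirDeriv v f) :=
    dirDeriv_snd_weightedMean L contDiff_const hf v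
  have hMt : dirDeriv (0, v) (timeDeriv (sphericalMean L f)) =
      timeDeriv (sphericalMean L (dirDeriv v f)) := by
    rw [timeDeriv, dirDeriv_comm h2, hM, timeDeriv]
  have hτ : ContDiff ℝ ∞ (fun q : ℝ × E => q.1) := contDiff_fst
  have hτ2 : ContDiff ℝ ∞ (fun q : ℝ × E => q.1 ^ 2 / 3) := by fun_prop
  have d1 : dirDeriv (0, v) (fun q : ℝ × E => q.1) = fun _ => 0 :=
    dirDeriv_clm (ContinuousLinearMap.fst ℝ ℝ E) _
  have d2 : dirDeriv (0, v) (fun q : ℝ × E => q.1 ^ 2 / 3) = fun _ => 0 := by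
    have : (fun q : ℝ × E => q.1 ^ 2 / 3) = fun q => (1 / 3) * (q.1 * q.1) := by
      funext q
      ring
    rw [this, dirDeriv_const_mul (hτ.mul hτ), dirDeriv_mul hτ hτ, d1]
    simp
  unfold waveSolution
  rw [dirDeriv_add (hτ.mul h2) (hτ2.mul h3), dirDeriv_mul hτ h2, dirDeriv_mul hτ2 h3, d1, d2, hM,
    hMt]
  simp

theorem waveSolution_sub (hf : ContDiff ℝ ∞ f) (hg : ContDiff ℝ ∞ g) :
    waveSolution L (fun x => f x - g x) = fun q => waveSolution L f q - waveSolution L g q := by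
  have hM : sphericalMean L (fun x => f x - g x) =
    fun q => sphericalMean L f q - sphericalMean L g q := weightedMean_sub L contDiff_const hf hg
  funext q
  simp only [waveSolution, timeDeriv, hM]
  rw [dirDeriv_sub (contDiff_sphericalMean L hf) (contDiff_sphericalMean L hg)]
  ring

theorem waveSolution_const_mul (hf : ContDiff ℝ ∞ f) (c : ℝ) :
    waveSolution L (fun x => c * f x) = fun q => c * waveSolution L f q := by
  have hM : sphericalMean L (fun x => c * f x) =
    fun q => c * sphericalMean L f q := weightedMean_const_mul L c
  funext q
  simp only [waveSolution, timeDeriv, hM]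
  rw [dirDeriv_const_mul (contDiff_sphericalMean L hf)]
  ring

/-- The solution over `e` only sees `f` on the affine subspace `e + range L`. -/
theorem waveSolution_eq_zero (hf : ContDiff ℝ ∞ f) {e : E} (h0 : ∀ η, f (e + L η) = 0) (t : ℝ) :
    waveSolution L f (t, e) = 0 := by
  have hM : ∀ t, sphericalMean L f (t, e) = 0 := by
    intro t
    simp only [sphericalMean, weightedMean, ← map_smul, h0]
    simp
  simp [waveSolution, hM, timeDeriv_eq_zero (contDiff_sphericalMean L hf) hM]

end WaveEquation

/-! ### The Klein-Gordon equation by descent from the wave equation. -/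

theorem hasTemperateGrowth_cos : Real.cos.HasTemperateGrowth := by
  refine ⟨Real.contDiff_cos, fun n => ⟨0, 1, fun x => ?_⟩⟩
  rw [norm_iteratedFDeriv_eq_norm_iteratedDeriv]
  obtain ⟨k, rfl | rfl⟩ := n.even_or_odd'
  · simpa [abs_mul] using Real.abs_cos_le_one x
  · simpa [abs_mul] using Real.abs_sin_le_one x

section KleinGordon

/-- The directions of propagation with speed `c` in space, together with an additional direction
that carries the mass. -/
noncomputable def kgFrame (c : ℝ) : FiveSpace →L[ℝ] Spacetime × ℝ :=
  ∑ j, (EuclideanSpace.proj j : FiveSpace →L[ℝ] ℝ).smulRight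
    ((![(c • coordVec 1, 0), (c • coordVec 2, 0), (c • coordVec 3, 0), (0, 1), (0, 0)] :
      Fin 5 → Spacetime × ℝ) j)

theorem frameVec_kgFrame (c : ℝ) (j : Fin 5) : frameVec (kgFrame c) j =
    (![(c • coordVec 1, 0), (c • coordVec 2, 0), (c • coordVec 3, 0), (0, 1), (0, 0)] :
      Fin 5 → Spacetime × ℝ) j := by
  simp [frameVec, kgFrame]

/-- The product of a function on spacetime and an eigenfunction in the additional direction. -/
noncomputable def massLift (m : ℝ) (F : Spacetime → ℝ) : Spacetime × ℝ → ℝ :=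
  fun z => F z.1 * Real.cos (m * z.2)

/-- The spatial Laplacian of a function on spacetime. -/
noncomputable def spaceLaplacian (F : Spacetime → ℝ) : Spacetime → ℝ :=
  fun p => ∑ i : Fin 3, pd i.succ (pd i.succ F) p

variable {F G : Spacetime → ℝ} (c m : ℝ)

theorem contDiff_pd (hF : ContDiff ℝ ∞ F) (α : Fin 4) : ContDiff ℝ ∞ (pd α F) :=
  contDiff_dirDeriv hF _

theorem hasTemperateGrowth_pd (hF : F.HasTemperateGrowth) (α : Fin 4) :
    (pd α F).HasTemperateGrowth := hasTemperateGrowth_dirDeriv hF _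

theorem contDiff_spaceLaplacian (hF : ContDiff ℝ ∞ F) : ContDiff ℝ ∞ (spaceLaplacian F) :=
  ContDiff.sum fun _ _ => contDiff_pd (contDiff_pd hF _) _

theorem contDiff_massLift (hF : ContDiff ℝ ∞ F) : ContDiff ℝ ∞ (massLift m F) := by
  have := Real.contDiff_cos (n := ∞)
  unfold massLift
  fun_prop

theorem hasTemperateGrowth_massLift (hF : F.HasTemperateGrowth) :
    (massLift m F).HasTemperateGrowth := by
  have h1 : (fun z : Spacetime × ℝ => m * z.2).HasTemperateGrowth :=
    (Function.HasTemperateGrowth.const m).mul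
      (ContinuousLinearMap.snd ℝ Spacetime ℝ).hasTemperateGrowth
  exact (hF.comp (ContinuousLinearMap.fst ℝ Spacetime ℝ).hasTemperateGrowth).mul
    (hasTemperateGrowth_cos.comp h1)

theorem dirDeriv_massLift (hF : ContDiff ℝ ∞ F) (v : Spacetime) :
    dirDeriv (v, 0) (massLift m F) = massLift m (dirDeriv v F) := by
  funext z
  refine HasDerivAt.dirDeriv_eq (contDiff_massLift m hF) ?_
  have := (hF.hasDerivAt_line z.1 v 0).mul_const (Real.cos (m * z.2))
  simpa [massLift] using this

theorem dirDeriv_dirDeriv_massLift (hF : ContDiff ℝ ∞ F) :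
    dirDeriv ((0 : Spacetime), (1 : ℝ)) (dirDeriv ((0 : Spacetime), (1 : ℝ)) (massLift m F)) =
      fun z => -m ^ 2 * massLift m F z := by
  have h1 : dirDeriv ((0 : Spacetime), (1 : ℝ)) (massLift m F) =
      fun z => F z.1 * (-Real.sin (m * z.2) * m) := by
    funext z
    refine HasDerivAt.dirDeriv_eq (contDiff_massLift m hF) ?_
    have h := (((hasDerivAt_id (0 : ℝ)).const_add z.2).const_mul m).cos.const_mul (F z.1)
    simpa [massLift] using h
  funext z
  refine HasDerivAt.dirDeriv_eq (contDiff_dirDeriv (contDiff_massLift m hF) _) ?_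
  rw [h1]
  have h := ((((hasDerivAt_id (0 : ℝ)).const_add z.2).const_mul m).sin.neg.mul_const m).const_mul
    (F z.1)
  refine (h.congr_deriv ?_).congr_of_eventuallyEq (Eventually.of_forall fun s => ?_)
  · simp [massLift]
    ring
  · simp

/-- The spatial part of the Klein-Gordon operator. -/
noncomputable def kgOperator (F : Spacetime → ℝ) : Spacetime → ℝ :=
  fun p => c ^ 2 * spaceLaplacian F p - m ^ 2 * F p

theorem dirDeriv_smul {E : Type} [NormedAddCommGroup E] [NormedSpace ℝ E] (a : ℝ) (v : E)
    (f : E → ℝ) : dirDeriv (a • v) f = fun x => a * dirDeriv v f x := by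
  funext x
  simp [dirDeriv]

/-- This is the method of descent: three scaled directions give `c² Δ`, the eigenfunction `cos (m
y)` in the fourth gives `-m²`, and the fifth frame vector is zero, so nothing depends on it. -/
theorem frameLaplacian_massLift (hF : ContDiff ℝ ∞ F) :
    frameLaplacian (kgFrame c) (massLift m F) = massLift m (kgOperator c m F) := by
  have hs : ∀ α : Fin 4, dirDeriv (c • coordVec α, (0 : ℝ)) (dirDeriv (c • coordVec α, (0 : ℝ))
      (massLift m F)) = fun z => c ^ 2 * massLift m (pd α (pd α F)) z := by
    intro α
    rw [dirDeriv_massLift m hF, dirDeriv_massLift m (contDiff_dirDeriv hF _), dirDeriv_smul,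
      dirDeriv_smul, dirDeriv_const_mul (contDiff_dirDeriv hF _)]
    funext z
    simp only [massLift, pd_eq_dirDeriv]
    ring
  have h0 : dirDeriv ((0 : Spacetime), (0 : ℝ)) (dirDeriv ((0 : Spacetime), (0 : ℝ))
      (massLift m F)) = fun _ => 0 := by
    funext z
    exact map_zero _
  funext z
  simp only [frameLaplacian, frameVec_kgFrame, Fin.sum_univ_five]
  simp only [Matrix.cons_val, hs, dirDeriv_dirDeriv_massLift m hF, h0]
  simp only [massLift, kgOperator, spaceLaplacian, Fin.sum_univ_three]
  simp only [Fin.succ_zero_eq_one, Fin.succ_one_eq_two, show (2 : Fin 3).succ = 3 from rfl]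
  ring

/-- The solution `U (t, p)` of `∂ₜ² U = (c² Δ - m²) U`, `U = 0` and `∂ₜ U = F p` at `t = 0`,
where `Δ` acts on the spatial part of `p`. -/
noncomputable def kgSolution (F : Spacetime → ℝ) : ℝ × Spacetime → ℝ :=
  fun q => waveSolution (kgFrame c) (massLift m F) (q.1, (q.2, 0))

/-- The inclusion of the parameters of `kgSolution` into those of `waveSolution`. -/
noncomputable def kgInclusion : ℝ × Spacetime →L[ℝ] ℝ × (Spacetime × ℝ) :=
  (ContinuousLinearMap.fst ℝ ℝ Spacetime).prod
    ((ContinuousLinearMap.snd ℝ ℝ Spacetime).prod 0)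

theorem kgSolution_eq (F : Spacetime → ℝ) : kgSolution c m F =
    fun q => waveSolution (kgFrame c) (massLift m F) (kgInclusion q) := rfl

theorem hasTemperateGrowth_kgSolution (hF : F.HasTemperateGrowth) :
    (kgSolution c m F).HasTemperateGrowth :=
  (hasTemperateGrowth_waveSolution _ (hasTemperateGrowth_massLift m hF)).comp
    kgInclusion.hasTemperateGrowth

theorem contDiff_kgSolution (hF : ContDiff ℝ ∞ F) : ContDiff ℝ ∞ (kgSolution c m F) :=
  (contDiff_waveSolution _ (contDiff_massLift m hF)).comp kgInclusion.contDiff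

theorem timeDeriv_kgSolution (hF : ContDiff ℝ ∞ F) : timeDeriv (kgSolution c m F) =
    fun q => timeDeriv (waveSolution (kgFrame c) (massLift m F)) (kgInclusion q) := by
  rw [kgSolution_eq, timeDeriv,
    dirDeriv_comp_clm (contDiff_waveSolution _ (contDiff_massLift m hF)) kgInclusion]
  rfl

theorem timeDeriv_timeDeriv_kgSolution (hF : ContDiff ℝ ∞ F) :
    timeDeriv (timeDeriv (kgSolution c m F)) = kgSolution c m (kgOperator c m F) := by
  rw [timeDeriv_kgSolution c m hF, timeDeriv, dirDeriv_comp_clm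
    (contDiff_timeDeriv (contDiff_waveSolution _ (contDiff_massLift m hF))) kgInclusion,
    kgSolution_eq, ← frameLaplacian_massLift c m hF,
    ← timeDeriv_timeDeriv_waveSolution _ (contDiff_massLift m hF)]
  rfl

theorem dirDeriv_snd_kgSolution (hF : ContDiff ℝ ∞ F) (v : Spacetime) :
    dirDeriv (0, v) (kgSolution c m F) = kgSolution c m (dirDeriv v F) := by
  rw [kgSolution_eq, dirDeriv_comp_clm (contDiff_waveSolution _ (contDiff_massLift m hF))
    kgInclusion, kgSolution_eq, ← dirDeriv_massLift m hF,
    ← dirDeriv_snd_waveSolution _ (contDiff_massLift m hF)]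
  rfl

theorem kgSolution_kgOperator (hF : ContDiff ℝ ∞ F) (q : ℝ × Spacetime) :
    kgSolution c m (kgOperator c m F) q =
      c ^ 2 * kgSolution c m (spaceLaplacian F) q - m ^ 2 * kgSolution c m F q := by
  have hl := contDiff_massLift m (contDiff_spaceLaplacian hF)
  have hl' := contDiff_massLift m hF
  have h : massLift m (kgOperator c m F) =
      fun z => c ^ 2 * massLift m (spaceLaplacian F) z - m ^ 2 * massLift m F z := by
    funext z
    simp only [massLift, kgOperator]
    ring
  simp only [kgSolution]
  rw [h, waveSolution_sub _ (contDiff_const.mul hl) (contDiff_const.mul hl'),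
    waveSolution_const_mul _ hl, waveSolution_const_mul _ hl']

theorem kgSolution_zero (F : Spacetime → ℝ) (p : Spacetime) : kgSolution c m F (0, p) = 0 :=
  waveSolution_zero _ _ _

theorem timeDeriv_kgSolution_zero (hF : ContDiff ℝ ∞ F) (p : Spacetime) :
    timeDeriv (kgSolution c m F) (0, p) = F p := by
  rw [timeDeriv_kgSolution c m hF]
  exact (timeDeriv_waveSolution_zero _ (contDiff_massLift m hF) (p, 0)).trans (by simp [massLift])

/-- The time coordinate of the spacetime argument is an inert parameter of `kgSolution`. It serves
as the initial time `s` of the data, both in the uniqueness proof and in Duhamel's integral. -/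
theorem kgFrame_time (η : FiveSpace) : (kgFrame c η).1.1 = 0 := by
  rw [clm_eq_sum_frameVec]
  have h1 : (coordVec 1).1 = 0 := rfl
  have h2 : (coordVec 2).1 = 0 := rfl
  have h3 : (coordVec 3).1 = 0 := rfl
  simp [frameVec_kgFrame, Fin.sum_univ_five, h1, h2, h3]

theorem kgSolution_eq_zero (hF : ContDiff ℝ ∞ F) {s : ℝ} (h0 : ∀ x, F (s, x) = 0) (t : ℝ)
    (x : Space) : kgSolution c m F (t, (s, x)) = 0 := by
  refine waveSolution_eq_zero _ (contDiff_massLift m hF) (fun η => ?_) t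
  have : (((s, x), (0 : ℝ)) + kgFrame c η).1 = (s, x + (kgFrame c η).1.2) := by
    ext <;> simp [kgFrame_time]
  simp [massLift, this, h0]

end KleinGordon

/-! ### The Klein-Gordon Cauchy problem on spacetime: uniqueness and homogeneous existence. -/

section KleinGordonSpacetime

/-- The Klein-Gordon operator `-k ∂ₜ² + Δ - r` on spacetime. -/
noncomputable def kleinGordon (k r : ℝ) (u : Spacetime → ℝ) : Spacetime → ℝ :=
  fun p => -k * pd 0 (pd 0 u) p + spaceLaplacian u p - r * u p

theorem pd_zero_eq_timeDeriv (u : Spacetime → ℝ) : pd 0 u = timeDeriv u := rfl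

theorem coordVec_succ (i : Fin 3) :
    coordVec i.succ = ((0 : ℝ), EuclideanSpace.single i (1 : ℝ)) := rfl

theorem exists_speed_mass {k r : ℝ} (hk : 0 < k) (hr : 0 ≤ r) :
    ∃ c m : ℝ, k * c ^ 2 = 1 ∧ k * m ^ 2 = r := by
  refine ⟨√(1 / k), √(r / k), ?_, ?_⟩
  · rw [Real.sq_sqrt (by positivity)]
    field_simp
  · rw [Real.sq_sqrt (by positivity)]
    field_simp

theorem timeDeriv_eq_kgOperator {k r c m : ℝ} (hk : 0 < k) (hc : k * c ^ 2 = 1)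
    (hm : k * m ^ 2 = r) {u : Spacetime → ℝ} (hu : ∀ p, kleinGordon k r u p = 0) :
    pd 0 (pd 0 u) = kgOperator c m u := by
  funext p
  have h := hu p
  simp only [kleinGordon] at h
  simp only [kgOperator]
  apply mul_left_cancel₀ hk.ne'
  linear_combination -h - spaceLaplacian u p * hc + u p * hm

/-- A smooth solution of the Klein-Gordon equation with vanishing Cauchy data vanishes. -/
theorem kleinGordon_unique_zero {k r : ℝ} (hk : 0 < k) (hr : 0 ≤ r) {u : Spacetime → ℝ}
    (hu : ContDiff ℝ ∞ u) (h : ∀ p, kleinGordon k r u p = 0) (h0 : ∀ x, u (0, x) = 0)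
    (h1 : ∀ x, pd 0 u (0, x) = 0) : u = 0 := by
  obtain ⟨c, m, hc, hm⟩ := exists_speed_mass hk hr
  have hop := timeDeriv_eq_kgOperator hk hc hm h
  have hut : ContDiff ℝ ∞ (pd 0 u) := contDiff_pd hu 0
  funext ⟨T, x⟩
  -- `Φ (τ, (s, x))` is the value at `x`, a time `τ` later, of the explicit solution whose Cauchy
  -- data are those of `u` at time `s`.
  let Φ : ℝ × Spacetime → ℝ := fun q =>
    timeDeriv (kgSolution c m u) q + kgSolution c m (pd 0 u) q
  have hU := contDiff_kgSolution c m hu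
  have hUt := contDiff_kgSolution c m hut
  have hΦ : ContDiff ℝ ∞ Φ := (contDiff_timeDeriv hU).add hUt
  -- Since `u` solves the equation, shifting the initial time has the same effect as letting more
  -- time elapse. Hence `Φ` is constant along `(T - s, (s, x))`; it equals `u (T, x)` at `s = T`,
  -- and `0` at `s = 0` because the data vanish there.
  have hs : dirDeriv ((0 : ℝ), coordVec 0) Φ = timeDeriv Φ := by
    have e1 : dirDeriv ((0 : ℝ), coordVec 0) Φ = fun q =>
        dirDeriv (0, coordVec 0) (timeDeriv (kgSolution c m u)) q
          + dirDeriv (0, coordVec 0) (kgSolution c m (pd 0 u)) q :=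
      dirDeriv_add (contDiff_timeDeriv hU) hUt _
    have e2 : timeDeriv Φ = fun q => timeDeriv (timeDeriv (kgSolution c m u)) q
        + timeDeriv (kgSolution c m (pd 0 u)) q := dirDeriv_add (contDiff_timeDeriv hU) hUt _
    rw [e1, e2, timeDeriv, dirDeriv_comm hU, dirDeriv_snd_kgSolution c m hu,
      dirDeriv_snd_kgSolution c m hut]
    change (fun q => timeDeriv (kgSolution c m (pd 0 u)) q + kgSolution c m (pd 0 (pd 0 u)) q) =
      fun q => timeDeriv (timeDeriv (kgSolution c m u)) q
        + timeDeriv (kgSolution c m (pd 0 u)) q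
    rw [timeDeriv_timeDeriv_kgSolution c m hu, hop]
    funext q
    ring
  have hconst : ∀ s, HasDerivAt (fun s : ℝ => Φ (T - s, (s, x))) 0 s := by
    intro s
    have hl := hΦ.hasDerivAt_line (T, ((0 : ℝ), x)) ((-1 : ℝ), coordVec 0) s
    have e : ∀ s : ℝ, (T, ((0 : ℝ), x)) + s • ((-1 : ℝ), coordVec 0) = (T - s, (s, x)) := by
      intro s
      ext <;> simp [coordVec]
      ring
    simp only [e] at hl
    refine hl.congr_deriv ?_
    have e2 : ((-1 : ℝ), coordVec 0) = (0, coordVec 0) - ((1 : ℝ), (0 : Spacetime)) := by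
      simp
    rw [e2, dirDeriv, map_sub]
    exact sub_eq_zero.2 (congrFun hs _)
  have hZ := is_const_of_deriv_eq_zero (fun s => (hconst s).differentiableAt)
    (fun s => (hconst s).deriv) T 0
  simp only [sub_self, sub_zero, Φ] at hZ
  rw [timeDeriv_kgSolution_zero c m hu, kgSolution_zero,
    kgSolution_eq_zero c m hut h1,
    timeDeriv_eq_zero hU (kgSolution_eq_zero c m hu h0 · x)] at hZ
  simpa using hZ

theorem kleinGordon_sub (k r : ℝ) {u v : Spacetime → ℝ} (hu : ContDiff ℝ ∞ u)
    (hv : ContDiff ℝ ∞ v) (p : Spacetime) :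
    kleinGordon k r (fun p => u p - v p) p = kleinGordon k r u p - kleinGordon k r v p := by
  have hd : ∀ α, pd α (pd α fun p => u p - v p) =
      fun p => pd α (pd α u) p - pd α (pd α v) p := by
    intro α
    simp only [pd_eq_dirDeriv]
    rw [dirDeriv_sub hu hv, dirDeriv_sub (contDiff_dirDeriv hu _) (contDiff_dirDeriv hv _)]
  simp only [kleinGordon, spaceLaplacian, hd, Finset.sum_sub_distrib]
  ring

theorem kleinGordon_add (k r : ℝ) {u v : Spacetime → ℝ} (hu : ContDiff ℝ ∞ u)
    (hv : ContDiff ℝ ∞ v) (p : Spacetime) :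
    kleinGordon k r (fun p => u p + v p) p = kleinGordon k r u p + kleinGordon k r v p := by
  have hd : ∀ α, pd α (pd α fun p => u p + v p) =
      fun p => pd α (pd α u) p + pd α (pd α v) p := by
    intro α
    simp only [pd_eq_dirDeriv]
    rw [dirDeriv_add hu hv, dirDeriv_add (contDiff_dirDeriv hu _) (contDiff_dirDeriv hv _)]
  simp only [kleinGordon, spaceLaplacian, hd, Finset.sum_add_distrib]
  ring

/-- Smooth solutions of the inhomogeneous Klein-Gordon equation are determined by their
Cauchy data. -/
theorem kleinGordon_unique {k r : ℝ} (hk : 0 < k) (hr : 0 ≤ r) {u v : Spacetime → ℝ}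
    (hu : ContDiff ℝ ∞ u) (hv : ContDiff ℝ ∞ v)
    (h : ∀ p, kleinGordon k r u p = kleinGordon k r v p) (h0 : ∀ x, u (0, x) = v (0, x))
    (h1 : ∀ x, pd 0 u (0, x) = pd 0 v (0, x)) : u = v := by
  have h := kleinGordon_unique_zero hk hr (hu.sub hv)
    (fun p => by rw [kleinGordon_sub k r hu hv, h, sub_self]) (fun x => by rw [h0, sub_self])
    (fun x => by rw [pd_eq_dirDeriv, dirDeriv_sub hu hv]; exact sub_eq_zero.2 (h1 x))
  funext p
  exact sub_eq_zero.1 (congrFun h p)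

/-- The inclusion `(t, x) ↦ (t, (0, x))` of the Cauchy problem with data at time zero. -/
noncomputable def cauchyInclusion : Spacetime →L[ℝ] ℝ × Spacetime :=
  (ContinuousLinearMap.fst ℝ ℝ Space).prod
    ((0 : Spacetime →L[ℝ] ℝ).prod (ContinuousLinearMap.snd ℝ ℝ Space))

theorem pd_zero_comp_cauchyInclusion {U : ℝ × Spacetime → ℝ} (hU : ContDiff ℝ ∞ U) :
    pd 0 (fun p => U (cauchyInclusion p)) = fun p => timeDeriv U (cauchyInclusion p) := by
  rw [pd_eq_dirDeriv, dirDeriv_comp_clm hU]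
  rfl

theorem pd_succ_comp_cauchyInclusion {U : ℝ × Spacetime → ℝ} (hU : ContDiff ℝ ∞ U) (i : Fin 3) :
    pd i.succ (fun p => U (cauchyInclusion p)) =
      fun p => dirDeriv (0, coordVec i.succ) U (cauchyInclusion p) := by
  rw [pd_eq_dirDeriv, dirDeriv_comp_clm hU]
  rfl

theorem kgSolution_spaceLaplacian (c m : ℝ) {F : Spacetime → ℝ} (hF : ContDiff ℝ ∞ F)
    (q : ℝ × Spacetime) : kgSolution c m (spaceLaplacian F) q =
      ∑ i : Fin 3, dirDeriv (0, coordVec i.succ) (dirDeriv (0, coordVec i.succ)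
        (kgSolution c m F)) q := by
  have hm := fun i : Fin 3 => contDiff_massLift m (contDiff_pd (contDiff_pd hF i.succ) i.succ)
  have h1 : ∀ i : Fin 3, dirDeriv (0, coordVec i.succ) (dirDeriv (0, coordVec i.succ)
      (kgSolution c m F)) = kgSolution c m (pd i.succ (pd i.succ F)) := by
    intro i
    rw [dirDeriv_snd_kgSolution c m hF, dirDeriv_snd_kgSolution c m (contDiff_dirDeriv hF _)]
    rfl
  simp only [h1]
  have h2 : massLift m (spaceLaplacian F) =
      fun z => ∑ i : Fin 3, massLift m (pd i.succ (pd i.succ F)) z := by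
    funext z
    simp only [massLift, spaceLaplacian, Finset.sum_mul]
  have h3 : sphericalMean (kgFrame c) (massLift m (spaceLaplacian F)) = fun q =>
      ∑ i : Fin 3, sphericalMean (kgFrame c) (massLift m (pd i.succ (pd i.succ F))) q := by
    rw [h2]
    exact weightedMean_sum _ contDiff_const fun i _ => hm i
  simp only [kgSolution, waveSolution]
  rw [h3, timeDeriv, dirDeriv_sum fun i _ => contDiff_sphericalMean _ (hm i)]
  simp only [Finset.sum_add_distrib, Finset.mul_sum, timeDeriv]

/-- Existence of slowly increasing solutions of the homogeneous equation with data `(0, b)`. -/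
theorem exists_kleinGordon_velocity {k r : ℝ} (hk : 0 < k) (hr : 0 ≤ r) {b : Space → ℝ}
    (hb : b.HasTemperateGrowth) : ∃ u : Spacetime → ℝ, u.HasTemperateGrowth ∧
      (∀ p, kleinGordon k r u p = 0) ∧ (∀ x, u (0, x) = 0) ∧ ∀ x, pd 0 u (0, x) = b x := by
  obtain ⟨c, m, hc, hm⟩ := exists_speed_mass hk hr
  have hF : (fun p : Spacetime => b p.2).HasTemperateGrowth :=
    hb.comp (ContinuousLinearMap.snd ℝ ℝ Space).hasTemperateGrowth
  have hU := contDiff_kgSolution c m hF.1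
  have hD : ∀ v, ContDiff ℝ ∞ (dirDeriv v (kgSolution c m fun p => b p.2)) :=
    fun v => contDiff_dirDeriv hU v
  refine ⟨fun p => kgSolution c m (fun p => b p.2) (cauchyInclusion p),
    (hasTemperateGrowth_kgSolution c m hF).comp cauchyInclusion.hasTemperateGrowth,
    fun p => ?_, fun x => kgSolution_zero c m _ _, fun x => ?_⟩
  · simp only [kleinGordon, spaceLaplacian]
    rw [pd_zero_comp_cauchyInclusion hU, pd_zero_comp_cauchyInclusion (contDiff_timeDeriv hU),
      timeDeriv_timeDeriv_kgSolution c m hF.1]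
    simp only [pd_succ_comp_cauchyInclusion hU, pd_succ_comp_cauchyInclusion (hD _)]
    rw [← kgSolution_spaceLaplacian c m hF.1, kgSolution_kgOperator c m hF.1, ← hm]
    linear_combination
      (-kgSolution c m (spaceLaplacian fun p => b p.2) (cauchyInclusion p)) * hc
  · rw [pd_zero_comp_cauchyInclusion hU]
    exact timeDeriv_kgSolution_zero c m hF.1 _

theorem pd_comm {u : Spacetime → ℝ} (hu : ContDiff ℝ ∞ u) (α β : Fin 4) :
    pd α (pd β u) = pd β (pd α u) := dirDeriv_comm hu _ _

theorem kleinGordon_pd (k r : ℝ) {u : Spacetime → ℝ} (hu : ContDiff ℝ ∞ u) (α : Fin 4) :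
    kleinGordon k r (pd α u) = pd α (kleinGordon k r u) := by
  have h2 : ∀ β, ContDiff ℝ ∞ (pd β (pd β u)) := fun β => contDiff_pd (contDiff_pd hu β) β
  have hc : ∀ β, pd β (pd β (pd α u)) = pd α (pd β (pd β u)) := by
    intro β
    rw [pd_comm hu β α, pd_comm (contDiff_pd hu β) β α]
  have e : pd α (kleinGordon k r u) = fun p => -k * pd α (pd 0 (pd 0 u)) p
      + (∑ i : Fin 3, pd α (pd i.succ (pd i.succ u)) p) - r * pd α u p := by
    have hs : ContDiff ℝ ∞ fun p => ∑ i : Fin 3, pd i.succ (pd i.succ u) p :=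
      contDiff_spaceLaplacian hu
    have hk : ContDiff ℝ ∞ fun p => -k * pd 0 (pd 0 u) p := contDiff_const.mul (h2 0)
    have hr : ContDiff ℝ ∞ fun p => r * u p := contDiff_const.mul hu
    unfold kleinGordon spaceLaplacian
    rw [pd_eq_dirDeriv α, dirDeriv_sub (hk.add hs) hr, dirDeriv_add hk hs,
      dirDeriv_const_mul (h2 0), dirDeriv_const_mul hu, dirDeriv_sum fun i _ => h2 i.succ]
    rfl
  rw [e]
  funext p
  simp only [kleinGordon, spaceLaplacian, hc]

theorem hasTemperateGrowth_slice {u : Spacetime → ℝ} (hu : u.HasTemperateGrowth) :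
    (fun x => u (0, x)).HasTemperateGrowth :=
  hu.comp (ContinuousLinearMap.inr ℝ ℝ Space).hasTemperateGrowth

theorem pd_succ_slice {u : Spacetime → ℝ} (hu : ContDiff ℝ ∞ u) (i : Fin 3) (x : Space) :
    pd i.succ u (0, x) = spd i (fun x => u (0, x)) x :=
  (congrFun (dirDeriv_comp_clm hu (ContinuousLinearMap.inr ℝ ℝ Space)
    (EuclideanSpace.single i (1 : ℝ))) x).symm

theorem spaceLaplacian_slice {u : Spacetime → ℝ} (hu : ContDiff ℝ ∞ u) (x : Space) :
    spaceLaplacian u (0, x) = slap (fun x => u (0, x)) x := by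
  simp only [spaceLaplacian, slap]
  refine Finset.sum_congr rfl fun i _ => ?_
  rw [pd_succ_slice (contDiff_pd hu _)]
  congr 1
  funext y
  exact pd_succ_slice hu i y

/-- Existence of slowly increasing solutions of the homogeneous Cauchy problem. -/
theorem exists_kleinGordon_homogeneous {k r : ℝ} (hk : 0 < k) (hr : 0 ≤ r) {a b : Space → ℝ}
    (ha : a.HasTemperateGrowth) (hb : b.HasTemperateGrowth) :
    ∃ u : Spacetime → ℝ, u.HasTemperateGrowth ∧ (∀ p, kleinGordon k r u p = 0) ∧
      (∀ x, u (0, x) = a x) ∧ ∀ x, pd 0 u (0, x) = b x := by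
  obtain ⟨u, hu, hu', hu0, hu1⟩ := exists_kleinGordon_velocity hk hr ha
  obtain ⟨v, hv, hv', hv0, hv1⟩ := exists_kleinGordon_velocity hk hr hb
  have hut := hasTemperateGrowth_pd hu 0
  -- By the equation, `∂_t² u` vanishes where `u` and `Δ u` do. So `∂_t u` is the solution with data
  -- `(a, 0)`, and adding `v` supplies the velocity `b`.
  have htt : ∀ x, pd 0 (pd 0 u) (0, x) = 0 := by
    intro x
    have h := hu' (0, x)
    simp only [kleinGordon, spaceLaplacian_slice hu.1, hu0] at h
    have : slap (fun _ : Space => (0 : ℝ)) x = 0 := by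
      simp [slap, spd_eq_dirDeriv, dirDeriv_const]
    rw [this] at h
    have : k * pd 0 (pd 0 u) (0, x) = 0 := by linarith
    exact (mul_eq_zero.1 this).resolve_left hk.ne'
  refine ⟨fun p => pd 0 u p + v p, hut.add hv, fun p => ?_, fun x => ?_, fun x => ?_⟩
  · rw [kleinGordon_add k r hut.1 hv.1, kleinGordon_pd k r hu.1, hv', funext hu',
      pd_eq_dirDeriv, dirDeriv_const, add_zero]
  · simp only [hu1, hv0, add_zero]
  · rw [pd_eq_dirDeriv, dirDeriv_add hut.1 hv.1]
    change pd 0 (pd 0 u) (0, x) + pd 0 v (0, x) = b x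
    rw [htt, hv1, zero_add]

end KleinGordonSpacetime

/-! ### Inhomogeneous equations by Duhamel's integral. -/

section Duhamel

theorem hasMoments_unitInterval : HasMoments (volume.restrict (Set.Ioc (0 : ℝ) 1)) := by
  intro k
  have : IntervalIntegrable (fun p : ℝ => (1 + ‖p‖) ^ k) volume 0 1 :=
    Continuous.intervalIntegrable (by fun_prop) _ _
  exact (intervalIntegrable_iff_integrableOn_Ioc_of_le zero_le_one).1 this

/-- The integrand of the Duhamel integral, rescaled to the unit interval. -/
noncomputable def duhamelIntegrand (V : ℝ × Spacetime → ℝ) : (ℝ × Spacetime) × ℝ → ℝ :=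
  fun z => z.1.1 * V (z.1.2.1 - z.1.1 * z.2, (z.1.1 * z.2, z.1.2.2))

/-- The integral `∫₀^τ V (t - s, (s, x)) ds` as a function of `(τ, (t, x))`. -/
noncomputable def duhamelPrimitive (V : ℝ × Spacetime → ℝ) : ℝ × Spacetime → ℝ :=
  fun q => ∫ σ, duhamelIntegrand V (q, σ) ∂(volume.restrict (Set.Ioc (0 : ℝ) 1))

variable {V : ℝ × Spacetime → ℝ}

theorem hasTemperateGrowth_prodMk {D E F : Type} [NormedAddCommGroup D] [NormedSpace ℝ D]
    [NormedAddCommGroup E] [NormedSpace ℝ E] [NormedAddCommGroup F] [NormedSpace ℝ F]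
    {f : D → E} {g : D → F} (hf : f.HasTemperateGrowth) (hg : g.HasTemperateGrowth) :
    (fun x => (f x, g x)).HasTemperateGrowth := by
  have h := ((ContinuousLinearMap.inl ℝ E F).hasTemperateGrowth.comp hf).add
    ((ContinuousLinearMap.inr ℝ E F).hasTemperateGrowth.comp hg)
  convert h using 1
  funext x
  simp

theorem hasTemperateGrowth_duhamelIntegrand (hV : V.HasTemperateGrowth) :
    (duhamelIntegrand V).HasTemperateGrowth := by
  have hσ : (fun z : (ℝ × Spacetime) × ℝ => z.2).HasTemperateGrowth :=
    (ContinuousLinearMap.snd ℝ (ℝ × Spacetime) ℝ).hasTemperateGrowth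
  have hτ : (fun z : (ℝ × Spacetime) × ℝ => z.1.1).HasTemperateGrowth :=
    ((ContinuousLinearMap.fst ℝ ℝ Spacetime).comp
      (ContinuousLinearMap.fst ℝ (ℝ × Spacetime) ℝ)).hasTemperateGrowth
  have ht : (fun z : (ℝ × Spacetime) × ℝ => z.1.2.1).HasTemperateGrowth :=
    ((ContinuousLinearMap.fst ℝ ℝ Space).comp ((ContinuousLinearMap.snd ℝ ℝ Spacetime).comp
      (ContinuousLinearMap.fst ℝ (ℝ × Spacetime) ℝ))).hasTemperateGrowth
  have hx : (fun z : (ℝ × Spacetime) × ℝ => z.1.2.2).HasTemperateGrowth :=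
    ((ContinuousLinearMap.snd ℝ ℝ Space).comp ((ContinuousLinearMap.snd ℝ ℝ Spacetime).comp
      (ContinuousLinearMap.fst ℝ (ℝ × Spacetime) ℝ))).hasTemperateGrowth
  exact hτ.mul (hV.comp (hasTemperateGrowth_prodMk (ht.sub (hτ.mul hσ))
    (hasTemperateGrowth_prodMk (hτ.mul hσ) hx)))

theorem hasTemperateGrowth_duhamelPrimitive (hV : V.HasTemperateGrowth) :
    (duhamelPrimitive V).HasTemperateGrowth :=
  hasMoments_unitInterval.hasTemperateGrowth_integral (hasTemperateGrowth_duhamelIntegrand hV)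

/-- The substitution `s = τ σ` is valid for either sign of `τ`. The rescaled form has a fixed
domain, which gives smoothness and growth; the unscaled form gives the derivative in the upper
limit. -/
theorem duhamelPrimitive_eq (V : ℝ × Spacetime → ℝ) (τ t : ℝ) (x : Space) :
    duhamelPrimitive V (τ, (t, x)) = ∫ s in (0 : ℝ)..τ, V (t - s, (s, x)) := by
  have h := intervalIntegral.smul_integral_comp_mul_left (a := 0) (b := 1)
    (fun s => V (t - s, (s, x))) τ
  simp only [mul_zero, mul_one] at h
  rw [← h, intervalIntegral.integral_of_le zero_le_one, smul_eq_mul, ← integral_const_mul]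
  rfl

theorem timeDeriv_duhamelPrimitive (hV : V.HasTemperateGrowth) (τ t : ℝ) (x : Space) :
    timeDeriv (duhamelPrimitive V) (τ, (t, x)) = V (t - τ, (τ, x)) := by
  refine timeDeriv_eq_of_hasDerivAt (hasTemperateGrowth_duhamelPrimitive hV).1 ?_
  simp only [duhamelPrimitive_eq]
  have hc : Continuous fun s : ℝ => V (t - s, (s, x)) := by
    have := hV.1.continuous
    fun_prop
  exact intervalIntegral.integral_hasDerivAt_right (hc.intervalIntegrable _ _)
    (hc.stronglyMeasurableAtFilter _ _) hc.continuousAt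

/-- Differentiation of the Duhamel primitive in a direction that leaves the integration limit
and the source time unchanged. -/
theorem dirDeriv_duhamelPrimitive (hV : V.HasTemperateGrowth) (a : ℝ) (y : Space) :
    dirDeriv (0, (a, y)) (duhamelPrimitive V) =
      duhamelPrimitive (dirDeriv (a, ((0 : ℝ), y)) V) := by
  funext q
  have hH := hasTemperateGrowth_duhamelIntegrand hV
  refine ((hH.smoothDominated hasMoments_unitInterval).fderiv_integral_apply q
    (0, (a, y))).trans ?_
  simp only [duhamelPrimitive]
  congr 1
  funext σ
  refine HasDerivAt.dirDeriv_eq hH.1 ?_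
  have h := (hV.1.hasDerivAt_line (q.2.1 - q.1 * σ, (q.1 * σ, q.2.2)) (a, ((0 : ℝ), y)) 0).const_mul
    q.1
  simp only [zero_smul, add_zero] at h
  refine h.congr_of_eventuallyEq (Eventually.of_forall fun s => ?_)
  obtain ⟨τ, t, x⟩ := q
  have e : t + s * a - τ * σ = t - τ * σ + s * a := by ring
  simp [duhamelIntegrand, e]

/-- The Duhamel integral `∫₀^t V (t - s, (s, x)) ds`. -/
noncomputable def duhamel (V : ℝ × Spacetime → ℝ) : Spacetime → ℝ :=
  fun p => duhamelPrimitive V (p.1, p)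

theorem duhamel_eq (V : ℝ × Spacetime → ℝ) : duhamel V = fun p => duhamelPrimitive V
    ((ContinuousLinearMap.fst ℝ ℝ Space).prod (ContinuousLinearMap.id ℝ Spacetime) p) := rfl

theorem hasTemperateGrowth_duhamel (hV : V.HasTemperateGrowth) :
    (duhamel V).HasTemperateGrowth :=
  (hasTemperateGrowth_duhamelPrimitive hV).comp ((ContinuousLinearMap.fst ℝ ℝ Space).prod
    (ContinuousLinearMap.id ℝ Spacetime)).hasTemperateGrowth

theorem duhamel_zero (V : ℝ × Spacetime → ℝ) (x : Space) : duhamel V (0, x) = 0 := by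
  simp [duhamel, duhamelPrimitive_eq]

theorem pd_zero_duhamel (hV : V.HasTemperateGrowth) : pd 0 (duhamel V) =
    fun p => V (0, p) + duhamel (timeDeriv V) p := by
  have hJ := (hasTemperateGrowth_duhamelPrimitive hV).1
  rw [duhamel_eq, pd_eq_dirDeriv, dirDeriv_comp_clm hJ]
  funext ⟨t, x⟩
  -- Time enters both as the limit of integration and in the integrand; the vector is split
  -- accordingly.
  have e : (ContinuousLinearMap.fst ℝ ℝ Space).prod (ContinuousLinearMap.id ℝ Spacetime)
      (coordVec 0) = ((1 : ℝ), (0 : Spacetime)) + (0, ((1 : ℝ), (0 : Space))) := by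
    ext <;> simp [coordVec]
  rw [e, dirDeriv, map_add]
  congr 1
  · refine (timeDeriv_duhamelPrimitive hV t t x).trans ?_
    simp
  · exact congrFun (dirDeriv_duhamelPrimitive hV 1 0) _

theorem pd_succ_duhamel (hV : V.HasTemperateGrowth) (i : Fin 3) : pd i.succ (duhamel V) =
    duhamel (dirDeriv (0, coordVec i.succ) V) := by
  have hJ := (hasTemperateGrowth_duhamelPrimitive hV).1
  rw [duhamel_eq, pd_eq_dirDeriv, dirDeriv_comp_clm hJ]
  funext p
  exact congrFun (dirDeriv_duhamelPrimitive hV 0 (EuclideanSpace.single i 1)) _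

theorem integrable_duhamelIntegrand (hV : V.HasTemperateGrowth) (q : ℝ × Spacetime) :
    Integrable (fun σ => duhamelIntegrand V (q, σ)) (volume.restrict (Set.Ioc (0 : ℝ) 1)) :=
  ((hasTemperateGrowth_duhamelIntegrand hV).smoothDominated hasMoments_unitInterval).integrable q

theorem duhamel_lincomb {W : ℝ × Spacetime → ℝ} (hV : V.HasTemperateGrowth)
    (hW : W.HasTemperateGrowth) (a b : ℝ) (p : Spacetime) :
    duhamel (fun q => a * V q - b * W q) p = a * duhamel V p - b * duhamel W p := by
  simp only [duhamel, duhamelPrimitive]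
  rw [← integral_const_mul, ← integral_const_mul,
    ← integral_sub ((integrable_duhamelIntegrand hV _).const_mul a)
      ((integrable_duhamelIntegrand hW _).const_mul b)]
  congr 1
  funext σ
  simp only [duhamelIntegrand]
  ring

theorem duhamel_sum {ι : Type} {s : Finset ι} {V : ι → ℝ × Spacetime → ℝ}
    (hV : ∀ i ∈ s, (V i).HasTemperateGrowth) (p : Spacetime) :
    duhamel (fun q => ∑ i ∈ s, V i q) p = ∑ i ∈ s, duhamel (V i) p := by
  simp only [duhamel, duhamelPrimitive]
  rw [← integral_finsetSum s fun i hi => integrable_duhamelIntegrand (hV i hi) _]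
  congr 1
  funext σ
  simp only [duhamelIntegrand, Finset.mul_sum]

/-- Slowly increasing solutions of the inhomogeneous equation with vanishing Cauchy data. -/
theorem exists_kleinGordon_source {k r : ℝ} (hk : 0 < k) (hr : 0 ≤ r) {F : Spacetime → ℝ}
    (hF : F.HasTemperateGrowth) : ∃ u : Spacetime → ℝ, u.HasTemperateGrowth ∧
      (∀ p, kleinGordon k r u p = F p) ∧ (∀ x, u (0, x) = 0) ∧ ∀ x, pd 0 u (0, x) = 0 := by
  obtain ⟨c, m, hc, hm⟩ := exists_speed_mass hk hr
  -- Differentiating the Duhamel integral twice produces the boundary term `G`, which the operator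
  -- multiplies by `-k`; since `k c² = 1`, the choice `G = -c² F` yields `F`.
  have hG : (fun p => -c ^ 2 * F p).HasTemperateGrowth :=
    (Function.HasTemperateGrowth.const (-c ^ 2)).mul hF
  set G : Spacetime → ℝ := fun p => -c ^ 2 * F p with hGdef
  have hU := hasTemperateGrowth_kgSolution c m hG
  set U := kgSolution c m G with hUdef
  have hUt : (timeDeriv U).HasTemperateGrowth := hasTemperateGrowth_dirDeriv hU _
  have hUi := fun i : Fin 3 => hasTemperateGrowth_dirDeriv hU (0, coordVec i.succ)
  have hUii := fun i : Fin 3 => hasTemperateGrowth_dirDeriv (hUi i) (0, coordVec i.succ)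
  have ht : pd 0 (duhamel U) = duhamel (timeDeriv U) := by
    rw [pd_zero_duhamel hU]
    funext p
    rw [hUdef, kgSolution_zero, zero_add]
  have hΔ : spaceLaplacian (duhamel U) = duhamel (kgSolution c m (spaceLaplacian G)) := by
    funext p
    rw [funext (kgSolution_spaceLaplacian c m hG.1), duhamel_sum fun i _ => hUii i]
    refine Finset.sum_congr rfl fun i _ => ?_
    rw [pd_succ_duhamel hU, pd_succ_duhamel (hUi i)]
  have hLap : (kgSolution c m (spaceLaplacian G)).HasTemperateGrowth := by
    rw [funext (kgSolution_spaceLaplacian c m hG.1)]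
    exact .sum fun i _ => hUii i
  have htt : pd 0 (pd 0 (duhamel U)) = fun p => G p +
      (c ^ 2 * duhamel (kgSolution c m (spaceLaplacian G)) p - m ^ 2 * duhamel U p) := by
    rw [ht, pd_zero_duhamel hUt]
    funext p
    rw [hUdef, timeDeriv_kgSolution_zero c m hG.1, timeDeriv_timeDeriv_kgSolution c m hG.1,
      funext (kgSolution_kgOperator c m hG.1), duhamel_lincomb hLap hU]
  refine ⟨duhamel U, hasTemperateGrowth_duhamel hU, fun p => ?_, duhamel_zero U, fun x => ?_⟩
  · simp only [kleinGordon]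
    rw [htt, hΔ, ← hm]
    simp only [hGdef]
    linear_combination (F p - duhamel (kgSolution c m (spaceLaplacian G)) p) * hc
  · rw [ht, duhamel_zero]

/-- Existence of slowly increasing solutions of the Cauchy problem. -/
theorem exists_kleinGordon {k r : ℝ} (hk : 0 < k) (hr : 0 ≤ r) {F : Spacetime → ℝ}
    {a b : Space → ℝ} (hF : F.HasTemperateGrowth) (ha : a.HasTemperateGrowth)
    (hb : b.HasTemperateGrowth) : ∃ u : Spacetime → ℝ, u.HasTemperateGrowth ∧
      (∀ p, kleinGordon k r u p = F p) ∧ (∀ x, u (0, x) = a x) ∧ ∀ x, pd 0 u (0, x) = b x := by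
  obtain ⟨u, hu, hu', hu0, hu1⟩ := exists_kleinGordon_homogeneous hk hr ha hb
  obtain ⟨v, hv, hv', hv0, hv1⟩ := exists_kleinGordon_source hk hr hF
  refine ⟨fun p => u p + v p, hu.add hv, fun p => ?_, fun x => ?_, fun x => ?_⟩
  · rw [kleinGordon_add k r hu.1 hv.1, hu', hv', zero_add]
  · simp only [hu0, hv0, add_zero]
  · rw [pd_eq_dirDeriv, dirDeriv_add hu.1 hv.1]
    change pd 0 u (0, x) + pd 0 v (0, x) = b x
    rw [hu1, hv1, add_zero]

end Duhamel

/-! ### The Helmholtz equation through the Laplace transform of waves. -/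

section Helmholtz

theorem one_add_pow_le_exp {m : ℝ} (hm : 0 < m) (k : ℕ) :
    ∃ C : ℝ, 0 ≤ C ∧ ∀ t : ℝ, 0 ≤ t → (1 + t) ^ k ≤ C * Real.exp (m * t) := by
  refine ⟨k.factorial / m ^ k * Real.exp m, by positivity, fun t ht => ?_⟩
  have h := Real.pow_div_factorial_le_exp (x := m * (1 + t)) (by positivity) k
  have e : Real.exp (m * (1 + t)) = Real.exp m * Real.exp (m * t) := by
    rw [← Real.exp_add]
    ring_nf
  rw [e, div_le_iff₀ (by positivity), mul_pow] at h
  have hmk : 0 < m ^ k := by positivity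
  calc (1 + t) ^ k = (m ^ k * (1 + t) ^ k) / m ^ k := by field_simp
    _ ≤ (Real.exp m * Real.exp (m * t) * k.factorial) / m ^ k := by gcongr
    _ = _ := by ring

/-- The measure `e^{-m t} dt` on the half-line. -/
noncomputable def laplaceMeasure (m : ℝ) : Measure ℝ :=
  (volume.restrict (Set.Ioi (0 : ℝ))).withDensity fun t => (Real.exp (-m * t)).toNNReal

theorem measurable_laplaceDensity (m : ℝ) :
    Measurable fun t : ℝ => (Real.exp (-m * t)).toNNReal := by fun_prop

theorem integrableOn_one_add_pow_mul_exp {m : ℝ} (hm : 0 < m) (k : ℕ) :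
    IntegrableOn (fun t : ℝ => Real.exp (-m * t) * (1 + ‖t‖) ^ k) (Set.Ioi 0) := by
  obtain ⟨C, hC, h⟩ := one_add_pow_le_exp (half_pos hm) k
  refine Integrable.mono' (g := fun t => C * Real.exp (-(m / 2) * t))
    ((exp_neg_integrableOn_Ioi 0 (half_pos hm)).const_mul C)
    (Continuous.aestronglyMeasurable (by fun_prop)) ?_
  refine (ae_restrict_iff' measurableSet_Ioi).2 (Eventually.of_forall fun t ht => ?_)
  have ht' : 0 ≤ t := le_of_lt ht
  rw [Real.norm_of_nonneg (by positivity), Real.norm_of_nonneg ht']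
  calc Real.exp (-m * t) * (1 + t) ^ k ≤ Real.exp (-m * t) * (C * Real.exp (m / 2 * t)) := by
        gcongr
        exact h t ht'
    _ = C * (Real.exp (-m * t) * Real.exp (m / 2 * t)) := by ring
    _ = C * Real.exp (-(m / 2) * t) := by
        rw [← Real.exp_add]
        ring_nf

theorem integral_laplaceMeasure (m : ℝ) (g : ℝ → ℝ) :
    ∫ t, g t ∂laplaceMeasure m = ∫ t in Set.Ioi 0, Real.exp (-m * t) * g t := by
  rw [laplaceMeasure, integral_withDensity_eq_integral_smul (measurable_laplaceDensity m)]
  simp only [NNReal.smul_def, Real.coe_toNNReal _ (Real.exp_pos _).le, smul_eq_mul]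

theorem integrable_laplaceMeasure_iff (m : ℝ) (g : ℝ → ℝ) :
    Integrable g (laplaceMeasure m) ↔
      IntegrableOn (fun t => Real.exp (-m * t) * g t) (Set.Ioi 0) := by
  rw [laplaceMeasure, integrable_withDensity_iff_integrable_smul (measurable_laplaceDensity m)]
  simp only [NNReal.smul_def, Real.coe_toNNReal _ (Real.exp_pos _).le, smul_eq_mul, IntegrableOn]

/-- With this, the general results on parameter integrals show that the Laplace transform preserves
slow increase and commutes with spatial derivatives. -/
theorem hasMoments_laplaceMeasure {m : ℝ} (hm : 0 < m) : HasMoments (laplaceMeasure m) := fun k =>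
  (integrable_laplaceMeasure_iff m _).2 (integrableOn_one_add_pow_mul_exp hm k)

theorem Function.HasTemperateGrowth.exists_abs_le {u : Spacetime → ℝ} (hu : u.HasTemperateGrowth)
    {m : ℝ} (hm : 0 < m) (x : Space) : ∃ C, ∀ t, 0 ≤ t → |u (t, x)| ≤ C * Real.exp (m * t) := by
  obtain ⟨k, C, hC0, hC⟩ := hu.norm_iteratedFDeriv_le_uniform 0
  obtain ⟨C', hC', h'⟩ := one_add_pow_le_exp hm k
  refine ⟨C * ((1 + ‖x‖) ^ k * C'), fun t ht => ?_⟩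
  have h := hC 0 le_rfl (t, x)
  rw [norm_iteratedFDeriv_zero, Real.norm_eq_abs] at h
  refine h.trans ?_
  rw [mul_assoc, mul_assoc]
  refine mul_le_mul_of_nonneg_left ((one_add_norm_prod_pow_le t x k).trans ?_) hC0
  rw [mul_comm, Real.norm_of_nonneg ht]
  exact mul_le_mul_of_nonneg_left (h' t ht) (by positivity)

theorem tendsto_exp_mul_temperate {u : Spacetime → ℝ} (hu : u.HasTemperateGrowth)
    {m : ℝ} (hm : 0 < m) (x : Space) :
    Tendsto (fun t => Real.exp (-m * t) * u (t, x)) atTop (𝓝 0) := by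
  obtain ⟨C, hC⟩ := hu.exists_abs_le (half_pos hm) x
  have h0 : Tendsto (fun t : ℝ => C * Real.exp (-(m / 2 * t))) atTop (𝓝 0) := by
    have := (Real.tendsto_exp_neg_atTop_nhds_zero.comp
      (tendsto_id.const_mul_atTop (half_pos hm))).const_mul C
    simpa using this
  refine squeeze_zero_norm' ?_ h0
  filter_upwards [eventually_ge_atTop 0] with t ht
  rw [Real.norm_eq_abs, abs_mul, abs_of_pos (Real.exp_pos _)]
  calc Real.exp (-m * t) * |u (t, x)| ≤ Real.exp (-m * t) * (C * Real.exp (m / 2 * t)) := by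
        gcongr
        exact hC t ht
    _ = C * (Real.exp (-m * t) * Real.exp (m / 2 * t)) := by ring
    _ = C * Real.exp (-(m / 2 * t)) := by
        rw [← Real.exp_add]
        ring_nf

theorem hasTemperateGrowth_swap {u : Spacetime → ℝ} (hu : u.HasTemperateGrowth) :
    (fun z : Space × ℝ => u (z.2, z.1)).HasTemperateGrowth :=
  hu.comp ((ContinuousLinearMap.snd ℝ Space ℝ).prod
    (ContinuousLinearMap.fst ℝ Space ℝ)).hasTemperateGrowth

/-- The Laplace transform with respect to time. -/
noncomputable def laplace (m : ℝ) (u : Spacetime → ℝ) : Space → ℝ :=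
  fun x => ∫ t, u (t, x) ∂laplaceMeasure m

variable {m : ℝ} {u : Spacetime → ℝ}

theorem hasTemperateGrowth_laplace (hm : 0 < m) (hu : u.HasTemperateGrowth) :
    (laplace m u).HasTemperateGrowth :=
  (hasMoments_laplaceMeasure hm).hasTemperateGrowth_integral (hasTemperateGrowth_swap hu)

theorem integrable_laplace (hm : 0 < m) (hu : u.HasTemperateGrowth) (x : Space) :
    Integrable (fun t => u (t, x)) (laplaceMeasure m) :=
  ((hasTemperateGrowth_swap hu).smoothDominated (hasMoments_laplaceMeasure hm)).integrable x

theorem spd_laplace (hm : 0 < m) (hu : u.HasTemperateGrowth) (i : Fin 3) :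
    spd i (laplace m u) = laplace m (pd i.succ u) := by
  funext x
  have hs := hasTemperateGrowth_swap hu
  refine ((hs.smoothDominated (hasMoments_laplaceMeasure hm)).fderiv_integral_apply x
    (EuclideanSpace.single i (1 : ℝ))).trans ?_
  simp only [laplace]
  congr 1
  funext t
  exact congrFun (dirDeriv_comp_clm hu.1 ((ContinuousLinearMap.snd ℝ Space ℝ).prod
    (ContinuousLinearMap.fst ℝ Space ℝ)) (EuclideanSpace.single i (1 : ℝ), (0 : ℝ))) (x, t)

theorem slap_laplace (hm : 0 < m) (hu : u.HasTemperateGrowth) :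
    slap (laplace m u) = laplace m (spaceLaplacian u) := by
  have hi := fun i : Fin 3 => hasTemperateGrowth_pd hu i.succ
  funext x
  simp only [slap, spd_laplace hm hu, spd_laplace hm (hi _), laplace, spaceLaplacian]
  rw [integral_finsetSum]
  exact fun i _ => integrable_laplace hm (hasTemperateGrowth_pd (hi i) _) x

/-- The integrand `e^{-mt} (∂_t² u - m² u)` is the time derivative of `e^{-mt} (∂_t u + m u)`, which
tends to zero at infinity. -/
theorem laplace_pd_zero_pd_zero (hm : 0 < m) (hu : u.HasTemperateGrowth) (x : Space) :
    laplace m (pd 0 (pd 0 u)) x - m ^ 2 * laplace m u x = -(pd 0 u (0, x) + m * u (0, x)) := by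
  have hut := hasTemperateGrowth_pd hu 0
  have hutt := hasTemperateGrowth_pd hut 0
  have hw : (fun p => pd 0 u p + m * u p).HasTemperateGrowth :=
    hut.add ((Function.HasTemperateGrowth.const m).mul hu)
  have hI : Integrable (fun t => pd 0 (pd 0 u) (t, x) - m ^ 2 * u (t, x)) (laplaceMeasure m) :=
    (integrable_laplace hm hutt x).sub ((integrable_laplace hm hu x).const_mul _)
  have hderiv : ∀ t ∈ Set.Ici (0 : ℝ), HasDerivAt
      (fun t => Real.exp (-m * t) * (pd 0 u (t, x) + m * u (t, x)))
      (Real.exp (-m * t) * (pd 0 (pd 0 u) (t, x) - m ^ 2 * u (t, x))) t := by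
    intro t _
    have h := (((hasDerivAt_id t).const_mul (-m)).exp).mul
      ((hasDerivAt_timeDeriv hut.1 t x).add ((hasDerivAt_timeDeriv hu.1 t x).const_mul m))
    refine h.congr_deriv ?_
    simp only [← pd_zero_eq_timeDeriv, id, Pi.add_apply]
    ring
  have h := integral_Ioi_of_hasDerivAt_of_tendsto' hderiv
    ((integrable_laplaceMeasure_iff m _).1 hI) (tendsto_exp_mul_temperate hw hm x)
  rw [← integral_laplaceMeasure, integral_sub (integrable_laplace hm hutt x)
    ((integrable_laplace hm hu x).const_mul _), integral_const_mul] at h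
  simpa [laplace] using h

/-- Let `v` be the massless wave with data `(0, -f)`. Its Laplace transform at `√r` works: `Δ`
becomes `∂_t²` under the integral, hence multiplication by `r` plus the boundary term `f`. -/
theorem exists_helmholtz {r : ℝ} (hr : 0 < r) {f : Space → ℝ} (hf : f.HasTemperateGrowth) :
    ∃ a : Space → ℝ, a.HasTemperateGrowth ∧ ∀ x, slap a x - r * a x = f x := by
  obtain ⟨v, hv, hv', hv0, hv1⟩ := exists_kleinGordon_velocity one_pos le_rfl hf.neg
  have hm : 0 < √r := Real.sqrt_pos.2 hr
  refine ⟨laplace (√r) v, hasTemperateGrowth_laplace hm hv, fun x => ?_⟩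
  have hvv : spaceLaplacian v = pd 0 (pd 0 v) := by
    funext p
    have := hv' p
    simp only [kleinGordon] at this
    linarith
  have h := laplace_pd_zero_pd_zero hm hv x
  rw [Real.sq_sqrt hr.le, hv0, hv1] at h
  rw [slap_laplace hm hv, hvv, h]
  simp

/-- The function `a(x) cosh(√r t)` is a wave with data `(a, 0)`, so by uniqueness it is the slowly
increasing wave with these data. Multiplied by `e^{-√r t}` it must tend to zero, yet its modulus
stays at least `|a x| / 2`. -/
theorem helmholtz_unique_zero {r : ℝ} (hr : 0 < r) {a : Space → ℝ} (ha : a.HasTemperateGrowth)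
    (h : ∀ x, slap a x - r * a x = 0) : a = 0 := by
  have hm : 0 < √r := Real.sqrt_pos.2 hr
  obtain ⟨v, hv, hv', hv0, hv1⟩ := exists_kleinGordon_homogeneous one_pos le_rfl ha
    (Function.HasTemperateGrowth.const (0 : ℝ))
  let w : Spacetime → ℝ := fun p => a p.2 * Real.cosh (√r * p.1)
  have has := ha.1
  have hw : ContDiff ℝ ∞ w := by
    have := Real.contDiff_cosh (n := ∞)
    fun_prop
  have hwt : pd 0 w = fun p => a p.2 * (Real.sinh (√r * p.1) * √r) := by
    funext ⟨t, x⟩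
    refine timeDeriv_eq_of_hasDerivAt hw ?_
    simpa using (((hasDerivAt_id t).const_mul (√r)).cosh).const_mul (a x)
  have hwtt : pd 0 (pd 0 w) = fun p => r * w p := by
    funext ⟨t, x⟩
    refine timeDeriv_eq_of_hasDerivAt (contDiff_pd hw 0) ?_
    rw [hwt]
    have h := ((((hasDerivAt_id t).const_mul (√r)).sinh).mul_const (√r)).const_mul (a x)
    refine h.congr_deriv ?_
    simp only [w, id]
    linear_combination a x * Real.cosh (√r * t) * Real.mul_self_sqrt hr.le
  have hwi : ∀ (i : Fin 3) {g : Space → ℝ}, ContDiff ℝ ∞ g →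
      pd i.succ (fun p => g p.2 * Real.cosh (√r * p.1)) =
        fun p => spd i g p.2 * Real.cosh (√r * p.1) := by
    intro i g hg
    have hgc : ContDiff ℝ ∞ fun p : Spacetime => g p.2 * Real.cosh (√r * p.1) := by
      have := Real.contDiff_cosh (n := ∞)
      fun_prop
    funext p
    refine HasDerivAt.dirDeriv_eq hgc ?_
    have := (hg.hasDerivAt_line p.2 (EuclideanSpace.single i 1) 0).mul_const
      (Real.cosh (√r * p.1))
    simpa [coordVec_succ, spd_eq_dirDeriv] using this
  have hwΔ : ∀ p, spaceLaplacian w p = slap a p.2 * Real.cosh (√r * p.1) := by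
    intro p
    simp only [spaceLaplacian, w, hwi _ has, hwi _ (contDiff_dirDeriv has _), slap,
      Finset.sum_mul, spd_eq_dirDeriv]
  have hwv : w = v := by
    refine kleinGordon_unique one_pos le_rfl hw hv.1 (fun p => ?_) (fun x => ?_) fun x => ?_
    · rw [hv']
      simp only [kleinGordon, hwtt, hwΔ, w]
      linear_combination Real.cosh (√r * p.1) * h p.2
    · simp [w, hv0]
    · simp [hwt, hv1]
  funext x
  have ht := tendsto_exp_mul_temperate hv hm x
  rw [← hwv] at ht
  have hb : ∀ t : ℝ, |a x| / 2 ≤ |Real.exp (-√r * t) * w (t, x)| := by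
    intro t
    have hc : 1 ≤ 2 * (Real.exp (-√r * t) * Real.cosh (√r * t)) := by
      rw [Real.cosh_eq, mul_div_assoc', mul_div_cancel₀ _ two_ne_zero, mul_add, ← Real.exp_add]
      have := Real.exp_pos (-√r * t)
      have := Real.exp_pos (-(√r * t))
      rw [show -√r * t + √r * t = 0 by ring, Real.exp_zero]
      nlinarith
    have e : |Real.exp (-√r * t) * w (t, x)| =
        |a x| * (Real.exp (-√r * t) * Real.cosh (√r * t)) := by
      rw [abs_mul, abs_mul, abs_of_pos (Real.exp_pos _), abs_of_pos (Real.cosh_pos _)]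
      ring
    rw [e]
    nlinarith [abs_nonneg (a x)]
  have hle : |a x| / 2 ≤ 0 := by
    have := ht.abs
    rw [abs_zero] at this
    exact ge_of_tendsto' this hb
  have : |a x| = 0 := le_antisymm (by linarith) (abs_nonneg _)
  simpa using this

end Helmholtz

/-! ### The diagonal form of the coefficient matrices. -/

section Coefficients

theorem gordon_eq (n : ℝ) : gordon n = Matrix.diagonal ![-n ^ 2, 1, 1, 1] := by
  ext i j
  fin_cases i <;> fin_cases j <;>
    simp [gordon, minkowski, fourVelocity]
  ring

theorem massTensor_eq (lam : ℝ) : massTensor lam = Matrix.diagonal ![-(1 - lam), 1, 1, 1] := by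
  ext i j
  fin_cases i <;> fin_cases j <;>
    simp [massTensor, minkowski, fourVelocity]
  ring

theorem gordon_inv_eq {n : ℝ} (hn : n ≠ 0) :
    (gordon n)⁻¹ = Matrix.diagonal ![-(n ^ 2)⁻¹, 1, 1, 1] := by
  rw [gordon_eq]
  apply Matrix.inv_eq_right_inv
  rw [Matrix.diagonal_mul_diagonal, ← Matrix.diagonal_one]
  congr 1
  ext i
  fin_cases i <;> simp [hn]

theorem sum_diagonal_mul (d : Fin 4 → ℝ) (f : Fin 4 → Fin 4 → ℝ) :
    ∑ α, ∑ β, Matrix.diagonal d α β * f α β = ∑ α, d α * f α α := by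
  refine Finset.sum_congr rfl fun α _ => ?_
  rw [Finset.sum_eq_single α (fun β _ h => by simp [Matrix.diagonal_apply_ne _ h.symm])
    (by simp)]
  simp

theorem sum_lorentz (k : ℝ) (f : Fin 4 → ℝ) :
    ∑ α, (![-k, 1, 1, 1] : Fin 4 → ℝ) α * f α = -k * f 0 + ∑ i : Fin 3, f i.succ := by
  rw [Fin.sum_univ_succ]
  simp [Fin.sum_univ_three]

theorem box_gordon (n : ℝ) (f : Spacetime → ℝ) (p : Spacetime) :
    box (gordon n) f p = -n ^ 2 * pd 0 (pd 0 f) p + spaceLaplacian f p := by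
  rw [box, gordon_eq, sum_diagonal_mul, sum_lorentz]
  rfl

theorem box_massTensor (lam : ℝ) (f : Spacetime → ℝ) (p : Spacetime) :
    box (massTensor lam) f p = -(1 - lam) * pd 0 (pd 0 f) p + spaceLaplacian f p := by
  rw [box, massTensor_eq, sum_diagonal_mul, sum_lorentz]
  rfl

end Coefficients

/-! ### Equivalence of the field equation with the constrained wave system. -/

section Proca

variable {n lam mu : ℝ} {A : Fin 4 → Spacetime → ℝ} {φ : Spacetime → ℝ}

/-- The divergence of the spatial part of a covector field on spacetime. -/
noncomputable def spatialDiv (A : Fin 4 → Spacetime → ℝ) : Spacetime → ℝ :=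
  fun p => ∑ i : Fin 3, pd i.succ (A i.succ) p

theorem contDiff_spatialDiv (hA : ∀ α, ContDiff ℝ ∞ (A α)) : ContDiff ℝ ∞ (spatialDiv A) :=
  ContDiff.sum fun _ _ => contDiff_pd (hA _) _

theorem pd_spatialDiv (hA : ∀ α, ContDiff ℝ ∞ (A α)) (α : Fin 4) :
    pd α (spatialDiv A) = fun p => ∑ i : Fin 3, pd α (pd i.succ (A i.succ)) p :=
  dirDeriv_sum (fun _ _ => contDiff_pd (hA _) _) _

/-- In the time component the two terms `n² ∂_t² A_0` cancel, so this component constrains the data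
instead of evolving them. -/
theorem fieldEquation_iff (hn : n ≠ 0) (hA : ∀ α, ContDiff ℝ ∞ (A α)) :
    FieldEquation n lam mu A ↔
      (∀ p, spaceLaplacian (A 0) p - pd 0 (spatialDiv A) p
        - mu ^ 2 / n ^ 2 * (1 - lam) * A 0 p = 0) ∧
      ∀ (i : Fin 3) (p : Spacetime), -n ^ 2 * pd 0 (pd 0 (A i.succ)) p
        + spaceLaplacian (A i.succ) p + n ^ 2 * pd i.succ (pd 0 (A 0)) p
        - pd i.succ (spatialDiv A) p - mu ^ 2 * A i.succ p = 0 := by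
  have hmass : ∀ (β : Fin 4) (p : Spacetime),
      ∑ σ, ∑ ρ, A σ p * massTensor lam σ ρ * (gordon n)⁻¹ ρ β =
        A β p * (![-(1 - lam), 1, 1, 1] : Fin 4 → ℝ) β *
          (![-(n ^ 2)⁻¹, 1, 1, 1] : Fin 4 → ℝ) β := by
    intro β p
    rw [massTensor_eq, gordon_inv_eq hn, Finset.sum_eq_single β, Finset.sum_eq_single β]
    · simp
    · intro ρ _ h
      simp [Matrix.diagonal_apply_ne _ h]
    · simp
    · intro σ _ h
      refine Finset.sum_eq_zero fun ρ _ => ?_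
      by_cases hρ : ρ = β
      · subst hρ
        simp [Matrix.diagonal_apply_ne _ h]
      · simp [Matrix.diagonal_apply_ne _ hρ]
    · simp
  have hgrad : ∀ (β : Fin 4) (p : Spacetime),
      ∑ σ, ∑ ρ, gordon n σ ρ * pd β (pd σ (A ρ)) p =
        -n ^ 2 * pd β (pd 0 (A 0)) p + pd β (spatialDiv A) p := by
    intro β p
    rw [gordon_eq, sum_diagonal_mul _ fun σ ρ => pd β (pd σ (A ρ)) p,
      sum_lorentz _ fun σ => pd β (pd σ (A σ)) p, pd_spatialDiv hA]
  simp only [FieldEquation, box_gordon, hgrad, hmass, Fin.forall_fin_succ (n := 3)]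
  refine and_congr (forall_congr' fun p => ?_) (forall_congr' fun i => forall_congr' fun p => ?_)
  · simp only [Matrix.cons_val_zero]
    refine iff_of_eq (congrArg (· = 0) ?_)
    ring
  · have h1 : ∀ a : ℝ, (![a, 1, 1, 1] : Fin 4 → ℝ) i.succ = 1 := by
      intro a
      fin_cases i <;> rfl
    rw [h1, h1]
    constructor <;> intro h <;> rw [← h] <;> ring

theorem divergenceConstraintAt_iff (hA : ∀ α, ContDiff ℝ ∞ (A α)) (p : Spacetime) :
    DivergenceConstraintAt lam A p ↔ spatialDiv A p = (1 - lam) * pd 0 (A 0) p := by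
  have h : ∀ α, (fun q => ∑ β, massTensor lam α β * A β q) =
      fun q => (![-(1 - lam), 1, 1, 1] : Fin 4 → ℝ) α * A α q := by
    intro α
    funext q
    rw [massTensor_eq, Finset.sum_eq_single α
      (fun β _ h => by simp [Matrix.diagonal_apply_ne _ h.symm]) (by simp)]
    simp
  have h2 : ∀ α, pd α (fun q => (![-(1 - lam), 1, 1, 1] : Fin 4 → ℝ) α * A α q) p =
      (![-(1 - lam), 1, 1, 1] : Fin 4 → ℝ) α * pd α (A α) p := fun α =>
    congrFun (dirDeriv_const_mul (hA α) _ _) p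
  simp only [DivergenceConstraintAt, h, h2]
  rw [sum_lorentz _ fun α => pd α (A α) p]
  change -(1 - lam) * pd 0 (A 0) p + spatialDiv A p = 0 ↔ _
  constructor <;> intro h <;> linarith

/-- Here `G^{i0} = -n² (∂_i A_0 - ∂_t A_i)`, so the Gauss constraint is the time component of the
field equation up to the factor `-n²`. -/
theorem gaussConstraintAt_iff (hn : n ≠ 0) (hA : ∀ α, ContDiff ℝ ∞ (A α)) (p : Spacetime) :
    GaussConstraintAt n lam mu A p ↔ spaceLaplacian (A 0) p - pd 0 (spatialDiv A) p
      - mu ^ 2 / n ^ 2 * (1 - lam) * A 0 p = 0 := by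
  have hdisp : ∀ i : Fin 3, displacement n A i.succ 0 =
      fun q => -n ^ 2 * (pd i.succ (A 0) q - pd 0 (A i.succ) q) := by
    intro i
    funext q
    simp only [displacement, gordon_eq, fieldStrength]
    rw [Finset.sum_eq_single i.succ, Finset.sum_eq_single 0]
    · have h1 : (![-n ^ 2, 1, 1, 1] : Fin 4 → ℝ) i.succ = 1 := by
        fin_cases i <;> rfl
      simp [h1]
    · intro σ _ h
      simp [Matrix.diagonal_apply_ne _ h.symm]
    · simp
    · intro ρ _ h
      refine Finset.sum_eq_zero fun σ _ => ?_
      simp [Matrix.diagonal_apply_ne _ h.symm]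
    · simp
  have hd : ∀ i : Fin 3, pd i.succ (displacement n A i.succ 0) p =
      -n ^ 2 * (pd i.succ (pd i.succ (A 0)) p - pd 0 (pd i.succ (A i.succ)) p) := by
    intro i
    have h1 := contDiff_pd (hA 0) i.succ
    have h2 := contDiff_pd (hA i.succ) 0
    rw [hdisp, pd_eq_dirDeriv, dirDeriv_const_mul (h1.sub h2), dirDeriv_sub h1 h2,
      pd_comm (hA i.succ) 0 i.succ]
    rfl
  have hm : ∑ α, massTensor lam α 0 * A α p = -(1 - lam) * A 0 p := by
    rw [massTensor_eq, Finset.sum_eq_single 0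
      (fun β _ h => by simp [Matrix.diagonal_apply_ne _ h]) (by simp)]
    simp
  have hn2 : n ^ 2 ≠ 0 := pow_ne_zero 2 hn
  have hq : n ^ 2 * (mu ^ 2 / n ^ 2) = mu ^ 2 := mul_div_cancel₀ _ hn2
  rw [GaussConstraintAt, hm]
  simp only [hd, pd_spatialDiv hA, spaceLaplacian]
  rw [← Finset.mul_sum, Finset.sum_sub_distrib]
  constructor
  · intro h
    apply mul_left_cancel₀ hn2
    linear_combination h - (1 - lam) * A 0 p * hq
  · intro h
    linear_combination n ^ 2 * h + (1 - lam) * A 0 p * hq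

theorem waveSystem_iff : WaveSystem n lam mu A φ ↔
    (∀ p, kleinGordon (1 - lam) (mu ^ 2 / n ^ 2 * (1 - lam)) (A 0) p = 0) ∧
    (∀ (i : Fin 3) (p : Spacetime), kleinGordon (n ^ 2) (mu ^ 2) (A i.succ) p =
      (1 - lam - n ^ 2) * pd i.succ φ p) ∧
    ∀ p, kleinGordon (1 - lam) (mu ^ 2 / n ^ 2 * (1 - lam)) φ p = 0 := by
  simp only [WaveSystem, box_gordon, box_massTensor, kleinGordon, sub_eq_zero]

theorem sdiv_slice (hA : ∀ α, ContDiff ℝ ∞ (A α)) (x : Space) :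
    sdiv (cauchyData A).1 x = spatialDiv A (0, x) := by
  simp only [sdiv, cauchyData, spatialDiv, pd_succ_slice (hA _)]

theorem sdiv_pd_slice (hA : ∀ α, ContDiff ℝ ∞ (A α)) (x : Space) :
    sdiv (cauchyData A).2 x = pd 0 (spatialDiv A) (0, x) := by
  rw [pd_spatialDiv hA]
  simp only [sdiv, cauchyData, pd_comm (hA _) 0, pd_succ_slice (contDiff_pd (hA _) 0)]

theorem auxiliaryData_iff (hlam : lam < 1) (hA : ∀ α, ContDiff ℝ ∞ (A α)) :
    AuxiliaryData lam (cauchyData A).1 (cauchyData A).2 φ ↔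
      ∀ x, spatialDiv A (0, x) = (1 - lam) * φ (0, x) ∧
        pd 0 (spatialDiv A) (0, x) = (1 - lam) * pd 0 φ (0, x) := by
  have h : 1 - lam ≠ 0 := (sub_pos.2 hlam).ne'
  simp only [AuxiliaryData, sdiv_slice hA, sdiv_pd_slice hA, eq_inv_mul_iff_mul_eq₀ h]
  refine forall_congr' fun x => and_congr eq_comm eq_comm

theorem kleinGordon_const_mul (k r c : ℝ) {u : Spacetime → ℝ} (hu : ContDiff ℝ ∞ u)
    (p : Spacetime) : kleinGordon k r (fun p => c * u p) p = c * kleinGordon k r u p := by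
  have hd : ∀ α, pd α (pd α fun p => c * u p) = fun p => c * pd α (pd α u) p := by
    intro α
    simp only [pd_eq_dirDeriv]
    rw [dirDeriv_const_mul hu, dirDeriv_const_mul (contDiff_dirDeriv hu _)]
  simp only [kleinGordon, spaceLaplacian, hd, ← Finset.mul_sum]
  ring

theorem kleinGordon_sum (k r : ℝ) {ι : Type} {s : Finset ι} {u : ι → Spacetime → ℝ}
    (hu : ∀ i ∈ s, ContDiff ℝ ∞ (u i)) (p : Spacetime) :
    kleinGordon k r (fun p => ∑ i ∈ s, u i p) p = ∑ i ∈ s, kleinGordon k r (u i) p := by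
  have hd : ∀ α, pd α (pd α fun p => ∑ i ∈ s, u i p) = fun p => ∑ i ∈ s, pd α (pd α (u i)) p := by
    intro α
    simp only [pd_eq_dirDeriv]
    rw [dirDeriv_sum hu, dirDeriv_sum fun i hi => contDiff_dirDeriv (hu i hi) _]
  simp only [kleinGordon, spaceLaplacian, hd, Finset.sum_add_distrib, Finset.sum_sub_distrib,
    Finset.mul_sum]
  rw [Finset.sum_comm]

theorem kleinGordon_spatialDiv (k r : ℝ) (hA : ∀ α, ContDiff ℝ ∞ (A α)) (p : Spacetime) :
    kleinGordon k r (spatialDiv A) p =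
      ∑ i : Fin 3, pd i.succ (kleinGordon k r (A i.succ)) p := by
  unfold spatialDiv
  rw [kleinGordon_sum k r fun i _ => contDiff_pd (hA _) _]
  simp only [kleinGordon_pd k r (hA _)]

/-- A solution of the field equation satisfies the divergence constraint everywhere. -/
theorem FieldEquation.spatialDiv_eq (hn : n ≠ 0) (hmu : mu ≠ 0) (hA : ∀ α, ContDiff ℝ ∞ (A α))
    (h : FieldEquation n lam mu A) (p : Spacetime) :
    spatialDiv A p = (1 - lam) * pd 0 (A 0) p := by
  obtain ⟨h0, hi⟩ := (fieldEquation_iff hn hA).1 h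
  have hD := contDiff_spatialDiv hA
  have hAt := contDiff_pd (hA 0) 0
  have hΔ := contDiff_spaceLaplacian (hA 0)
  have hn2 : n ^ 2 ≠ 0 := pow_ne_zero 2 hn
  -- The time derivative of the time component.
  have e0 : pd 0 (spaceLaplacian (A 0)) p - pd 0 (pd 0 (spatialDiv A)) p
      - mu ^ 2 / n ^ 2 * (1 - lam) * pd 0 (A 0) p = 0 := by
    have hz : (fun p => spaceLaplacian (A 0) p - pd 0 (spatialDiv A) p
        - mu ^ 2 / n ^ 2 * (1 - lam) * A 0 p) = fun _ => 0 := funext h0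
    have hz' := congrFun (congrArg (pd 0) hz) p
    rw [pd_eq_dirDeriv, dirDeriv_sub (hΔ.sub (contDiff_pd hD 0)) (contDiff_const.mul (hA 0)),
      dirDeriv_sub hΔ (contDiff_pd hD 0), dirDeriv_const_mul (hA 0),
      show pd 0 (fun _ : Spacetime => (0 : ℝ)) = fun _ => 0 from dirDeriv_const 0 _] at hz'
    exact hz'
  have eΔ : pd 0 (spaceLaplacian (A 0)) p = spaceLaplacian (pd 0 (A 0)) p := by
    have : pd 0 (spaceLaplacian (A 0)) = fun p => ∑ i : Fin 3, pd 0 (pd i.succ (pd i.succ (A 0))) p :=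
      dirDeriv_sum (fun _ _ => contDiff_pd (contDiff_pd (hA 0) _) _) _
    rw [this]
    simp only [spaceLaplacian, pd_comm (contDiff_pd (hA 0) _) 0, pd_comm (hA 0) 0]
  -- The divergence of the spatial components.
  have e1 : kleinGordon (n ^ 2) (mu ^ 2) (spatialDiv A) p + n ^ 2 * spaceLaplacian (pd 0 (A 0)) p
      - spaceLaplacian (spatialDiv A) p = 0 := by
    have hz : ∀ i : Fin 3, kleinGordon (n ^ 2) (mu ^ 2) (A i.succ) = fun p =>
        pd i.succ (spatialDiv A) p - n ^ 2 * pd i.succ (pd 0 (A 0)) p := by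
      intro i
      funext p
      have := hi i p
      simp only [kleinGordon]
      linarith
    rw [kleinGordon_spatialDiv _ _ hA]
    have hz' : ∀ i : Fin 3, pd i.succ (kleinGordon (n ^ 2) (mu ^ 2) (A i.succ)) p =
        pd i.succ (pd i.succ (spatialDiv A)) p
          - n ^ 2 * pd i.succ (pd i.succ (pd 0 (A 0))) p := by
      intro i
      rw [hz, pd_eq_dirDeriv, dirDeriv_sub (contDiff_pd hD _)
        (contDiff_const.mul (contDiff_pd hAt _)), dirDeriv_const_mul (contDiff_pd hAt _)]
      rfl
    simp only [hz', Finset.sum_sub_distrib, ← Finset.mul_sum, spaceLaplacian]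
    ring
  rw [eΔ] at e0
  have hm2 : mu ^ 2 ≠ 0 := pow_ne_zero 2 hmu
  apply mul_left_cancel₀ hm2
  simp only [kleinGordon] at e1
  have hq : n ^ 2 * (mu ^ 2 / n ^ 2) = mu ^ 2 := mul_div_cancel₀ _ hn2
  -- All derivatives of second and higher order cancel in this combination, the counterpart of `∂_α
  -- ∂_β G^{αβ} = 0`, and only the mass terms survive.
  linear_combination n ^ 2 * e0 - e1 + (1 - lam) * pd 0 (A 0) p * hq

/-- Replacing `∂_i A_i` by `(1 - lam) ∂_t A_0` in both components gives the equations for `A_0` and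
`A_i` with `φ = ∂_t A_0`; the equation for `φ` is the time derivative of the one for `A_0`. -/
theorem FieldEquation.constraints_and_waveSystem (hn : n ≠ 0) (hmu : mu ≠ 0)
    (hlam : lam < 1) (hA : ∀ α, ContDiff ℝ ∞ (A α)) (h : FieldEquation n lam mu A) :
    (∀ p, DivergenceConstraintAt lam A p) ∧ (∀ p, GaussConstraintAt n lam mu A p) ∧
      AuxiliaryData lam (cauchyData A).1 (cauchyData A).2 (pd 0 (A 0)) ∧
      WaveSystem n lam mu A (pd 0 (A 0)) := by
  have hdiv := h.spatialDiv_eq hn hmu hA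
  obtain ⟨h0, hi⟩ := (fieldEquation_iff hn hA).1 h
  have hdt : ∀ α, pd α (spatialDiv A) = fun p => (1 - lam) * pd α (pd 0 (A 0)) p := by
    intro α
    rw [funext hdiv]
    exact dirDeriv_const_mul (contDiff_pd (hA 0) 0) _ _
  have hk0 : ∀ p, kleinGordon (1 - lam) (mu ^ 2 / n ^ 2 * (1 - lam)) (A 0) p = 0 := by
    intro p
    have := h0 p
    rw [hdt] at this
    simp only [kleinGordon]
    linarith
  refine ⟨fun p => (divergenceConstraintAt_iff hA p).2 (hdiv p),
    fun p => (gaussConstraintAt_iff hn hA p).2 (h0 p), (auxiliaryData_iff hlam hA).2 fun x =>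
    ⟨hdiv _, congrFun (hdt 0) _⟩, waveSystem_iff.2 ⟨hk0, fun i p => ?_, fun p => ?_⟩⟩
  · have := hi i p
    rw [hdt] at this
    simp only [kleinGordon]
    linarith
  · rw [kleinGordon_pd _ _ (hA 0), funext hk0, pd_eq_dirDeriv, dirDeriv_const]

/-- A solution of the wave system whose data satisfy the constraints solves the field equation. -/
theorem WaveSystem.fieldEquation (hn : n ≠ 0) (hlam : lam < 1)
    (hA : ∀ α, ContDiff ℝ ∞ (A α)) (hφ : ContDiff ℝ ∞ φ) (h : WaveSystem n lam mu A φ)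
    (hdiv : ∀ x, DivergenceConstraintAt lam A (0, x))
    (hgauss : ∀ x, GaussConstraintAt n lam mu A (0, x))
    (haux : AuxiliaryData lam (cauchyData A).1 (cauchyData A).2 φ) :
    φ = pd 0 (A 0) ∧ FieldEquation n lam mu A := by
  have hk : 0 < 1 - lam := sub_pos.2 hlam
  have hn2 : 0 < n ^ 2 := by positivity
  have hr : 0 ≤ mu ^ 2 / n ^ 2 * (1 - lam) := by positivity
  obtain ⟨h0, hi, hφw⟩ := waveSystem_iff.1 h
  have haux' := (auxiliaryData_iff hlam hA).1 haux
  have hD := contDiff_spatialDiv hA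
  -- Both sides solve the same homogeneous equation. Their values at `t = 0` agree by the divergence
  -- constraint; their velocities agree by comparing the Gauss constraint with the wave equation for
  -- `A_0`.
  have hφt : φ = pd 0 (A 0) := by
    refine kleinGordon_unique hk hr hφ (contDiff_pd (hA 0) 0) (fun p => ?_) (fun x => ?_)
      fun x => ?_
    · rw [hφw, kleinGordon_pd _ _ (hA 0), funext h0, pd_eq_dirDeriv, dirDeriv_const]
    · have h1 := (divergenceConstraintAt_iff hA _).1 (hdiv x)
      rw [(haux' x).1] at h1
      exact mul_left_cancel₀ hk.ne' h1
    · have h1 := (gaussConstraintAt_iff hn hA _).1 (hgauss x)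
      rw [(haux' x).2] at h1
      have h2 := h0 (0, x)
      simp only [kleinGordon] at h2
      apply mul_left_cancel₀ hk.ne'
      linarith
  -- Both sides solve the equation with `k = n²`, `r = mu²` and source `(1 - lam - n²) Δ φ`: the
  -- left by taking the divergence of the equations for `A_i`, the right by eliminating `∂_t² φ`
  -- with its own equation.
  have hDφ : spatialDiv A = fun p => (1 - lam) * φ p := by
    refine kleinGordon_unique hn2 (sq_nonneg mu) hD (contDiff_const.mul hφ) (fun p => ?_)
      (fun x => (haux' x).1) fun x => ?_
    · rw [kleinGordon_const_mul _ _ _ hφ, kleinGordon_spatialDiv _ _ hA]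
      have hz : ∀ i : Fin 3, pd i.succ (kleinGordon (n ^ 2) (mu ^ 2) (A i.succ)) p =
          (1 - lam - n ^ 2) * pd i.succ (pd i.succ φ) p := by
        intro i
        rw [funext (hi i), pd_eq_dirDeriv, dirDeriv_const_mul (contDiff_pd hφ _)]
        rfl
      simp only [hz, ← Finset.mul_sum]
      change (1 - lam - n ^ 2) * spaceLaplacian φ p = _
      have h3 := hφw p
      simp only [kleinGordon] at h3 ⊢
      have hq : n ^ 2 * (mu ^ 2 / n ^ 2) = mu ^ 2 := mul_div_cancel₀ _ hn2.ne'
      linear_combination -n ^ 2 * h3 - (1 - lam) * φ p * hq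
    · exact (haux' x).2.trans
        (congrFun (dirDeriv_const_mul hφ (1 - lam) (coordVec 0)) (0, x)).symm
  have hdt : ∀ α, pd α (spatialDiv A) = fun p => (1 - lam) * pd α φ p := by
    intro α
    rw [hDφ]
    exact dirDeriv_const_mul hφ _ _
  refine ⟨hφt, (fieldEquation_iff hn hA).2 ⟨fun p => ?_, fun i p => ?_⟩⟩
  · have := h0 p
    rw [hdt, hφt]
    simp only [kleinGordon] at this
    linarith
  · have := hi i p
    rw [hdt, ← hφt]
    simp only [kleinGordon] at this
    linarith

/-- Smooth solutions of the wave system are determined by their initial data. -/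
theorem WaveSystem.unique (hn : n ≠ 0) (hlam : lam < 1) {A' : Fin 4 → Spacetime → ℝ}
    {φ' : Spacetime → ℝ} {a b : Fin 3 → Space → ℝ} {a₀ : Space → ℝ}
    (hA : ∀ α, ContDiff ℝ ∞ (A α)) (hφ : ContDiff ℝ ∞ φ) (hA' : ∀ α, ContDiff ℝ ∞ (A' α))
    (hφ' : ContDiff ℝ ∞ φ') (h : WaveSystem n lam mu A φ) (h' : WaveSystem n lam mu A' φ')
    (hd : InitialData lam a b a₀ A φ) (hd' : InitialData lam a b a₀ A' φ') :
    A' = A ∧ φ' = φ := by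
  have hk : 0 < 1 - lam := sub_pos.2 hlam
  have hn2 : 0 < n ^ 2 := by positivity
  have hr : 0 ≤ mu ^ 2 / n ^ 2 * (1 - lam) := by positivity
  obtain ⟨h0, hi, hφw⟩ := waveSystem_iff.1 h
  obtain ⟨h0', hi', hφw'⟩ := waveSystem_iff.1 h'
  obtain ⟨hc, hz, hx⟩ := hd
  obtain ⟨hc', hz', hx'⟩ := hd'
  have e : φ' = φ := kleinGordon_unique hk hr hφ' hφ (fun p => by rw [hφw, hφw'])
    (fun x => by rw [(hx x).1, (hx' x).1]) (fun x => by rw [(hx x).2, (hx' x).2])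
  have hcc : cauchyData A' = cauchyData A := hc'.trans hc.symm
  have hc1 : ∀ i x, A' (Fin.succ i) (0, x) = A (Fin.succ i) (0, x) := fun i x =>
    congrFun (congrFun (congrArg Prod.fst hcc) i) x
  have hc2 : ∀ i x, pd 0 (A' (Fin.succ i)) (0, x) = pd 0 (A (Fin.succ i)) (0, x) := fun i x =>
    congrFun (congrFun (congrArg Prod.snd hcc) i) x
  refine ⟨funext fun α => ?_, e⟩
  refine Fin.cases ?_ (fun i => ?_) α
  · exact kleinGordon_unique hk hr (hA' 0) (hA 0) (fun p => by rw [h0, h0'])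
      (fun x => by rw [(hz x).1, (hz' x).1]) (fun x => by rw [(hz x).2, (hz' x).2])
  · exact kleinGordon_unique hn2 (sq_nonneg mu) (hA' _) (hA _) (fun p => by rw [hi, hi', e])
      (hc1 i) (hc2 i)

theorem hasTemperateGrowth_sdiv {a : Fin 3 → Space → ℝ} (ha : SlowlyIncreasing a) :
    (sdiv a).HasTemperateGrowth :=
  .sum fun i _ => hasTemperateGrowth_dirDeriv (ha i) _

/-- The wave system has a slowly increasing solution with given slowly increasing data. -/
theorem exists_waveSystem (hn : n ≠ 0) (hlam : lam < 1) {a b : Fin 3 → Space → ℝ}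
    {a₀ : Space → ℝ} (ha : SlowlyIncreasing a) (hb : SlowlyIncreasing b)
    (ha₀ : a₀.HasTemperateGrowth) : ∃ (A : Fin 4 → Spacetime → ℝ) (φ : Spacetime → ℝ),
      SlowlyIncreasing A ∧ φ.HasTemperateGrowth ∧ InitialData lam a b a₀ A φ ∧
        WaveSystem n lam mu A φ := by
  have hk : 0 < 1 - lam := sub_pos.2 hlam
  have hn2 : 0 < n ^ 2 := by positivity
  have hr : 0 ≤ mu ^ 2 / n ^ 2 * (1 - lam) := by positivity
  have hda : (fun x => (1 - lam)⁻¹ * sdiv a x).HasTemperateGrowth :=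
    (Function.HasTemperateGrowth.const _).mul (hasTemperateGrowth_sdiv ha)
  have hdb : (fun x => (1 - lam)⁻¹ * sdiv b x).HasTemperateGrowth :=
    (Function.HasTemperateGrowth.const _).mul (hasTemperateGrowth_sdiv hb)
  obtain ⟨φ, hφ, hφw, hφ0, hφ1⟩ := exists_kleinGordon_homogeneous hk hr hda hdb
  obtain ⟨A₀, hA₀, hA₀w, hA₀0, hA₀1⟩ := exists_kleinGordon_homogeneous hk hr ha₀ hda
  have hsrc : ∀ i : Fin 3, (fun p => (1 - lam - n ^ 2) * pd i.succ φ p).HasTemperateGrowth :=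
    fun i => (Function.HasTemperateGrowth.const _).mul (hasTemperateGrowth_pd hφ _)
  choose A₁ hA₁ hA₁w hA₁0 hA₁1 using fun i : Fin 3 =>
    exists_kleinGordon hn2 (sq_nonneg mu) (hsrc i) (ha i) (hb i)
  refine ⟨Fin.cons A₀ A₁, φ, Fin.cases hA₀ hA₁, hφ, ⟨?_, fun x => ⟨hA₀0 x, hA₀1 x⟩,
    fun x => ⟨hφ0 x, hφ1 x⟩⟩, waveSystem_iff.2 ⟨hA₀w, hA₁w, hφw⟩⟩
  exact Prod.ext (funext fun i => funext fun x => hA₁0 i x)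
    (funext fun i => funext fun x => hA₁1 i x)

/-- The prescribed `∂_t A_0` is the divergence constraint solved for it, and the Helmholtz equation
is the Gauss constraint at `t = 0`. -/
theorem InitialData.constraints (hn : n ≠ 0) (hlam : lam < 1) {a b : Fin 3 → Space → ℝ}
    {a₀ : Space → ℝ} (hA : ∀ α, ContDiff ℝ ∞ (A α)) (hd : InitialData lam a b a₀ A φ)
    (hH : HelmholtzEquation n lam mu b a₀) :
    (∀ x, DivergenceConstraintAt lam A (0, x)) ∧ (∀ x, GaussConstraintAt n lam mu A (0, x)) ∧
      AuxiliaryData lam (cauchyData A).1 (cauchyData A).2 φ := by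
  have hk : 1 - lam ≠ 0 := (sub_pos.2 hlam).ne'
  obtain ⟨hc, hz, hx⟩ := hd
  have h1 := sdiv_slice hA
  have h2 := sdiv_pd_slice hA
  rw [hc] at h1 h2
  refine ⟨fun x => (divergenceConstraintAt_iff hA _).2 ?_,
    fun x => (gaussConstraintAt_iff hn hA _).2 ?_, by rw [hc]; exact hx⟩
  · rw [← h1, (hz x).2, mul_inv_cancel_left₀ hk]
  · rw [← h2, spaceLaplacian_slice (hA 0)]
    simp only [(hz _).1]
    have := hH x
    rw [← this]
    ring

theorem FieldEquation.initialData (hn : n ≠ 0) (hmu : mu ≠ 0) (hlam : lam < 1)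
    (hA : ∀ α, ContDiff ℝ ∞ (A α)) (h : FieldEquation n lam mu A) :
    InitialData lam (cauchyData A).1 (cauchyData A).2 (fun x => A 0 (0, x)) A (pd 0 (A 0)) ∧
      HelmholtzEquation n lam mu (cauchyData A).2 fun x => A 0 (0, x) := by
  obtain ⟨_, hgauss, haux, _⟩ := h.constraints_and_waveSystem hn hmu hlam hA
  refine ⟨⟨rfl, fun x => ⟨rfl, (haux x).1⟩, haux⟩, fun x => ?_⟩
  have := (gaussConstraintAt_iff hn hA _).1 (hgauss (0, x))
  rw [spaceLaplacian_slice (hA 0), ← sdiv_pd_slice hA] at this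
  linear_combination this

theorem existsUnique_helmholtzEquation (hn : n ≠ 0) (hmu : mu ≠ 0) (hlam : lam < 1)
    {b : Fin 3 → Space → ℝ} (hb : SlowlyIncreasing b) :
    ∃! a₀ : Space → ℝ, a₀.HasTemperateGrowth ∧ HelmholtzEquation n lam mu b a₀ := by
  have hk : 0 < 1 - lam := sub_pos.2 hlam
  have hr : 0 < (1 - lam) / n ^ 2 * mu ^ 2 := by positivity
  obtain ⟨a₀, ha₀, h⟩ := exists_helmholtz hr (hasTemperateGrowth_sdiv hb)
  refine ⟨a₀, ⟨ha₀, h⟩, fun a₁ ⟨ha₁, h₁⟩ => ?_⟩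
  have hs : slap (fun x => a₁ x - a₀ x) = fun x => slap a₁ x - slap a₀ x := by
    funext x
    simp only [slap, spd_eq_dirDeriv, dirDeriv_sub ha₁.1 ha₀.1,
      dirDeriv_sub (contDiff_dirDeriv ha₁.1 _) (contDiff_dirDeriv ha₀.1 _),
      Finset.sum_sub_distrib]
  have h0 := helmholtz_unique_zero hr (ha₁.sub ha₀) fun x => by
    have e : slap (a₁ - a₀) = fun x => slap a₁ x - slap a₀ x := hs
    rw [e, Pi.sub_apply]
    linear_combination h₁ x - h x
  exact sub_eq_zero.1 h0

end Proca

/-! ### Assembly of the three statements. -/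

theorem proposition2 (n lam mu : ℝ) (hn : 0 < n) (hmu : mu ≠ 0) (hlam : lam < 1)
    (hlam' : lam ≠ 1 - n ^ 2) :
    -- slowly increasing solutions are uniquely parameterised by arbitrary slowly increasing data
    Set.BijOn cauchyData
      {A : Fin 4 → Spacetime → ℝ | SlowlyIncreasing A ∧ FieldEquation n lam mu A}
      {d : (Fin 3 → Space → ℝ) × (Fin 3 → Space → ℝ) |
        SlowlyIncreasing d.1 ∧ SlowlyIncreasing d.2} ∧
    -- a smooth field is a solution iff the constraints hold at `t = 0` and it arises from
    -- the system of wave equations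
    (∀ A : Fin 4 → Spacetime → ℝ, (∀ α, ContDiff ℝ ∞ (A α)) →
      (FieldEquation n lam mu A ↔
        (∀ x : Space, DivergenceConstraintAt lam A (0, x)) ∧
        (∀ x : Space, GaussConstraintAt n lam mu A (0, x)) ∧
        ∃ φ : Spacetime → ℝ, ContDiff ℝ ∞ φ ∧
          AuxiliaryData lam (cauchyData A).1 (cauchyData A).2 φ ∧
          WaveSystem n lam mu A φ)) ∧
    -- construction of the solution from the data: first the elliptic equation, then the system
    (∀ a b : Fin 3 → Space → ℝ, SlowlyIncreasing a → SlowlyIncreasing b →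
      (∃! a₀ : Space → ℝ, a₀.HasTemperateGrowth ∧ HelmholtzEquation n lam mu b a₀) ∧
      (∀ a₀ : Space → ℝ, a₀.HasTemperateGrowth → HelmholtzEquation n lam mu b a₀ →
        ∃ (A : Fin 4 → Spacetime → ℝ) (φ : Spacetime → ℝ),
          SlowlyIncreasing A ∧ φ.HasTemperateGrowth ∧
          InitialData lam a b a₀ A φ ∧ WaveSystem n lam mu A φ ∧
          FieldEquation n lam mu A ∧ φ = pd 0 (A 0) ∧
          (∀ (A' : Fin 4 → Spacetime → ℝ) (φ' : Spacetime → ℝ),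
            (∀ α, ContDiff ℝ ∞ (A' α)) → ContDiff ℝ ∞ φ' →
            InitialData lam a b a₀ A' φ' → WaveSystem n lam mu A' φ' →
            A' = A ∧ φ' = φ))) := by
  have hn0 := hn.ne'
  have construct : ∀ (a b : Fin 3 → Space → ℝ) (a₀ : Space → ℝ), SlowlyIncreasing a →
      SlowlyIncreasing b → a₀.HasTemperateGrowth → HelmholtzEquation n lam mu b a₀ →
      ∃ (A : Fin 4 → Spacetime → ℝ) (φ : Spacetime → ℝ), SlowlyIncreasing A ∧
        φ.HasTemperateGrowth ∧ InitialData lam a b a₀ A φ ∧ WaveSystem n lam mu A φ ∧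
        FieldEquation n lam mu A ∧ φ = pd 0 (A 0) := by
    intro a b a₀ ha hb ha₀ hH
    obtain ⟨A, φ, hA, hφ, hd, hw⟩ := exists_waveSystem (mu := mu) hn0 hlam ha hb ha₀
    obtain ⟨h1, h2, h3⟩ := hd.constraints hn0 hlam (fun α => (hA α).1) hH
    obtain ⟨h4, h5⟩ := hw.fieldEquation hn0 hlam (fun α => (hA α).1) hφ.1 h1 h2 h3
    exact ⟨A, φ, hA, hφ, hd, hw, h5, h4⟩
  refine ⟨⟨?_, ?_, ?_⟩, fun A hA => ⟨fun h => ?_, ?_⟩, fun a b ha hb =>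
    ⟨existsUnique_helmholtzEquation hn0 hmu hlam hb, fun a₀ ha₀ hH => ?_⟩⟩
  · rintro A ⟨hA, -⟩
    exact ⟨fun i => hasTemperateGrowth_slice (hA _),
      fun i => hasTemperateGrowth_slice (hasTemperateGrowth_pd (hA _) 0)⟩
  · rintro A ⟨hA, h⟩ A' ⟨hA', h'⟩ hc
    have hs := fun α => (hA α).1
    have hs' := fun α => (hA' α).1
    obtain ⟨hd, hH⟩ := h.initialData hn0 hmu hlam hs
    obtain ⟨hd', hH'⟩ := h'.initialData hn0 hmu hlam hs'
    have hw := (h.constraints_and_waveSystem hn0 hmu hlam hs).2.2.2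
    have hw' := (h'.constraints_and_waveSystem hn0 hmu hlam hs').2.2.2
    rw [← hc] at hd' hH'
    have hb : SlowlyIncreasing (cauchyData A).2 := fun i =>
      hasTemperateGrowth_slice (hasTemperateGrowth_pd (hA _) 0)
    -- The data of `A_i` determine `A_0` at `t = 0`, because both restrictions are slowly increasing
    -- solutions of one Helmholtz equation. From here on uniqueness holds for all smooth solutions
    -- of the wave system.
    have ha₀ := (existsUnique_helmholtzEquation hn0 hmu hlam hb).unique
      ⟨hasTemperateGrowth_slice (hA' 0), hH'⟩ ⟨hasTemperateGrowth_slice (hA 0), hH⟩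
    rw [ha₀] at hd'
    exact (hw.unique hn0 hlam hs (contDiff_pd (hs 0) 0) hs' (contDiff_pd (hs' 0) 0) hw'
      hd hd').1.symm
  · rintro ⟨a, b⟩ ⟨ha, hb⟩
    obtain ⟨a₀, ⟨ha₀, hH⟩, -⟩ := existsUnique_helmholtzEquation hn0 hmu hlam hb
    obtain ⟨A, φ, hA, -, hd, -, hF, -⟩ := construct a b a₀ ha hb ha₀ hH
    exact ⟨A, ⟨hA, hF⟩, hd.1⟩
  · obtain ⟨h1, h2, h3, h4⟩ := h.constraints_and_waveSystem hn0 hmu hlam hA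
    exact ⟨fun x => h1 _, fun x => h2 _, _, contDiff_pd (hA 0) 0, h3, h4⟩
  · rintro ⟨h1, h2, φ, hφ, h3, h4⟩
    exact (h4.fieldEquation hn0 hlam hA hφ h1 h2 h3).2
  · obtain ⟨A, φ, hA, hφ, hd, hw, hF, ht⟩ := construct a b a₀ ha hb ha₀ hH
    exact ⟨A, φ, hA, hφ, hd, hw, hF, ht, fun A' φ' hA' hφ' hd' hw' =>
      hw.unique hn0 hlam (fun α => (hA α).1) hφ.1 hA' hφ' hw' hd hd'⟩
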